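/- Consider synchronous computation in rounds on the $n$-dimensional hypercube $Q_n$ (vertex set $\{0,1\}^n$, two nodes being neighbours when they differ in exactly one coordinate), regarded as a symmetric digraph with $n2^n$ arcs. In each round every node may send a message to each of its neighbours, and at most $f$ of the arcs fail: a message sent over a failed arc is not received, and the receiver cannot tell this from no message having been sent. The set of failed arcs is arbitrary subject to this bound and may change from round to round. Nodes are deterministic and have unique identities. In the (binary, uniform) Consensus problem every node starts with an initial value in $\{0,1\}$ and must irrevocably decide a value, so that every node eventually decides (termination), all nodes decide the same value (agreement), and if all initial values equal $v$ then every node decides $v$ (validity). An algorithm solves Consensus if this holds for all initial values and all sequences of failures; it solves it in $k$ rounds if moreover all nodes have always decided by the end of round $k$. Consensus is solvable in exactly $k$ rounds if $k$ is the least number of rounds in which some algorithm solves it. Then: 1. if $n\ge 1$ and $f\ge n$, Consensus is not solvable; 2. if $n\ge 3$ and $f=n-1$, Consensus is solvable in exactly $n+2$ rounds; 3. if $n\ge 4$ and $f=n-2$, Consensus is solvable in exactly $n+1$ rounds; 4. if $0\le f<n-2$, Consensus is solvable in exactly $n$ rounds. -/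

import Mathlib

namespace MobileOmission

/-- A communication event over the network `G` is a spanning sub-digraph `H ≤ G`; its arcs are the
links on which messages are delivered.  `omissions G H` is the set of arcs of `G` that are lost. -/
def omissions {V : Type} (G H : Digraph V) : Set (V × V) :=
  {a | G.Adj a.1 a.2 ∧ ¬ H.Adj a.1 a.2}

/-- The set `O_f(G)` of the communication events over `G` with at most `f` omissions. -/
def boundedOmissions {V : Type} (G : Digraph V) (f : ℕ) : Set (Digraph V) :=
  {H | H ≤ G ∧ (omissions G H).encard ≤ (f : ℕ∞)}

/-- The mobile omission scheme `R^ω`: all infinite sequences of events of `R`.  The letter `w r` is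
the event of the round that leads from time `r` to time `r + 1`. -/
def mobileScheme {V : Type} (R : Set (Digraph V)) : Set (ℕ → Digraph V) :=
  {w | ∀ r, w r ∈ R}

/-- A deterministic synchronous algorithm on the set of nodes `V`, for nodes with binary inputs and
binary decisions.  Nodes have unique identities: each may run its own code. -/
structure Algorithm (V : Type) where
  /-- local states -/
  State : Type
  /-- messages -/
  Msg : Type
  /-- the initial state of a node with a given initial value -/
  init : V → Bool → State
  /-- `send u s v`: what node `u` in state `s` sends to `v` (`none`: no message) -/
  send : V → State → V → Option Msg
  /-- `step v s m`: the new state of node `v`, in state `s`, when `m u` is what it received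
  from `u` (`none`: nothing received) -/
  step : V → State → (V → Option Msg) → State
  /-- the decision recorded in a local state (`none`: undecided) -/
  decision : V → State → Option Bool

open Classical in
/-- The state of every node after `r` rounds of `A`, started with the initial values `ι`, subject to
the scenario `w`: a message from `u` to `v` is received in a round only if the arc from `u` to `v`
belongs to the event of that round. -/
noncomputable def Algorithm.run {V : Type} (A : Algorithm V) (w : ℕ → Digraph V) (ι : V → Bool) :
    ℕ → V → A.State
  | 0 => fun v => A.init v (ι v)
  | r + 1 => fun v => A.step v (A.run w ι r v)
      (fun u => if (w r).Adj u v then A.send u (A.run w ι r u) v else none)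

/-- The decision, if any, of node `v` after `r` rounds. -/
noncomputable def Algorithm.decided {V : Type} (A : Algorithm V) (w : ℕ → Digraph V) (ι : V → Bool)
    (r : ℕ) (v : V) : Option Bool :=
  A.decision v (A.run w ι r v)

/-- Decisions are irrevocable in every execution subject to the omission scheme `O`. -/
def Algorithm.Irrevocable {V : Type} (A : Algorithm V) (O : Set (ℕ → Digraph V)) : Prop :=
  ∀ w ∈ O, ∀ (ι : V → Bool) (r : ℕ) (v : V) (b : Bool),
    A.decided w ι r v = some b → A.decided w ι (r + 1) v = some b

/-- The configuration after `r` rounds meets the specification of (uniform, binary) Consensus: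
every node has decided, agreement, and validity. -/
def Algorithm.ConsensusAt {V : Type} (A : Algorithm V) (w : ℕ → Digraph V) (ι : V → Bool)
    (r : ℕ) : Prop :=
  (∀ v, ∃ b, A.decided w ι r v = some b) ∧
  (∀ u v, A.decided w ι r u = A.decided w ι r v) ∧
  (∀ b, (∀ v, ι v = b) → ∀ v, A.decided w ι r v = some b)

/-- Consensus is `O`-solvable: some algorithm reaches Consensus after finitely many rounds, for all
initial values and in every scenario of `O`. -/
def ConsensusSolvable {V : Type} (O : Set (ℕ → Digraph V)) : Prop :=
  ∃ A : Algorithm V, A.Irrevocable O ∧ ∀ w ∈ O, ∀ ι : V → Bool, ∃ r, A.ConsensusAt w ι r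

/-- Consensus is `O`-solvable in `k` rounds: some algorithm has reached Consensus at the end of
round `k`, for all initial values and in every scenario of `O`. -/
def ConsensusSolvableIn {V : Type} (O : Set (ℕ → Digraph V)) (k : ℕ) : Prop :=
  ∃ A : Algorithm V, A.Irrevocable O ∧ ∀ w ∈ O, ∀ ι : V → Bool, A.ConsensusAt w ι k

/-- Consensus is `O`-solvable in exactly `k` rounds: `k` is the minimum number of rounds. -/
def ConsensusSolvableInExactly {V : Type} (O : Set (ℕ → Digraph V)) (k : ℕ) : Prop :=
  IsLeast {j | ConsensusSolvableIn O j} k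

/-- The `n`-dimensional hypercube, as a symmetric digraph. -/
def hypercube (n : ℕ) : Digraph (Fin n → Bool) where
  Adj x y := hammingDist x y = 1

end MobileOmission

/-!
Whether Consensus is solvable in `k` rounds depends only on broadcast. A *containment* of a node `v`
is an increasing sequence of sets `S 0 ∋ v`, `S 1`, … such that at most `f` arcs lead from `S r` to
the complement of `S (r + 1)`: letting these arcs fail keeps the information of `v` inside `S r`. If
some `v` has no containment that misses a node at time `k`, its initial value can be flooded and
decided (`consensusSolvableIn_of_forall_containment`). If every node has one, then two executions
that differ at one node at some time can be continued so that a node never sees the difference;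
changing the events from the last round backwards, the receptions of one node at a time, one finds
that the decisions do not depend on the failures, and then that they do not depend on the initial
values either, against validity (`not_consensusSolvableIn`). For unbounded algorithms, compactness
of the space of scenarios bounds the number of rounds (`consensusSolvableIn_of_consensusSolvable`).

On the hypercube, seen as the graph of subsets of an `n`-set with source `∅`, the lower bounds are
explicit containments: `isContainment_isolate`, `isContainment_delayTwo`, `isContainment_delayOne`
and `isContainment_ball`.

For the upper bounds, `T` rounds and `f = T - 3` failures are considered in dimension `T`, `T - 1`
or `T - 2`. Polarization by a reflection of the cube (`leak_polarize_le`) does not increase the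
number of leaking arcs; hence a containment that misses a vertex may be taken to miss the antipode
of the source and to be closed under passing to subsets and to smaller elements
(`exists_isCompressed`). Counting the leaks of the first two rounds, many vertices `insert c p`, for
a fixed `p` with at most one element, are informed at time `2`, and dually many vertices
`(insert c q)ᶜ` are uninformed at time `T - 2`. Between such a vertex and such a co-vertex the
distance is exactly the number of remaining rounds, and the failures have to meet a random shortest
path at least once on average (`one_le_flow`). Summed over all pairs this needs more than `f`
failures per round: in dimension `T` and `T - 1` because two disjoint subcubes are to be cut at the
same time (`star_flow_two`), in dimension `T - 2` by a direct estimate from dimension `6` on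
(`star_flow`), while in dimensions `3`, `4`, `5` a few further intervals have to be included.
-/

namespace MobileOmission

/-! ### Containments and the lower bound -/

/-- The arcs of `G` that lead from `S` to the complement of `S'`: those that have to fail in a round
so that a message held by the nodes of `S` is afterwards held by nodes of `S'` only. -/
def leak {V : Type} (G : Digraph V) (S S' : Set V) : Set (V × V) :=
  {a | G.Adj a.1 a.2 ∧ a.1 ∈ S ∧ a.2 ∉ S'}

/-- A containment: sets of nodes `S 0 ⊆ S 1 ⊆ …` such that `f` failures in each round suffice to
keep at time `r` within `S r` any information that starts within `S 0`. -/
structure IsContainment {V : Type} (G : Digraph V) (f : ℕ) (S : ℕ → Set V) : Prop where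
  mono : ∀ r, S r ⊆ S (r + 1)
  leak_le : ∀ r, (leak G (S r) (S (r + 1))).encard ≤ (f : ℕ∞)

/-- The events in which exactly the leaks of `S` fail. -/
def confine {V : Type} (G : Digraph V) (S : ℕ → Set V) (r : ℕ) : Digraph V where
  Adj u v := G.Adj u v ∧ ¬ (u ∈ S r ∧ v ∉ S (r + 1))

theorem confine_mem {V : Type} {G : Digraph V} {f : ℕ} {S : ℕ → Set V} (hS : IsContainment G f S)
    (r : ℕ) : confine G S r ∈ boundedOmissions G f := by
  refine ⟨fun u v h => h.1, le_trans (Set.encard_le_encard ?_) (hS.leak_le r)⟩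
  rintro ⟨u, v⟩ ⟨h1, h2⟩
  simp only [confine] at h1 h2
  simp only [leak, Set.mem_ofPred_eq]
  tauto

/-- The scenario that follows `w` for `r` rounds and `w'` afterwards. -/
def splice {V : Type} (w : ℕ → Digraph V) (r : ℕ) (w' : ℕ → Digraph V) : ℕ → Digraph V :=
  fun i => if i < r then w i else w' (i - r)

theorem splice_mem {V : Type} {R : Set (Digraph V)} {w w' : ℕ → Digraph V}
    (h : w ∈ mobileScheme R) (h' : w' ∈ mobileScheme R) (r : ℕ) :
    splice w r w' ∈ mobileScheme R := by
  intro i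
  unfold splice
  split_ifs
  · exact h i
  · exact h' _

theorem splice_of_lt {V : Type} (w w' : ℕ → Digraph V) {i r : ℕ} (h : i < r) :
    splice w r w' i = w i := if_pos h

theorem splice_add {V : Type} (w w' : ℕ → Digraph V) (i r : ℕ) :
    splice w r w' (r + i) = w' i := by
  simp [splice]

theorem Algorithm.run_congr {V : Type} (A : Algorithm V) {w w' : ℕ → Digraph V} (ι : V → Bool)
    {r : ℕ} (h : ∀ i < r, w i = w' i) : A.run w ι r = A.run w' ι r := by
  induction r with
  | zero => rfl
  | succ r ih =>
    have h1 := ih fun i hi => h i (by omega)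
    funext v
    rw [Algorithm.run, Algorithm.run, h1, h r (by omega)]

/-- Two executions that differ only within `S 0` at time `r`, and are then subject to the events
confining `S`, differ only within `S i` at time `r + i`. -/
theorem Algorithm.run_eq_of_confine {V : Type} (A : Algorithm V) {G : Digraph V} {S : ℕ → Set V}
    (hS : ∀ r, S r ⊆ S (r + 1)) {w w' : ℕ → Digraph V} {ι ι' : V → Bool} {r : ℕ}
    (hw : ∀ i, w (r + i) = confine G S i) (hw' : ∀ i, w' (r + i) = confine G S i)
    (h : ∀ u ∉ S 0, A.run w ι r u = A.run w' ι' r u) (i : ℕ) :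
    ∀ u ∉ S i, A.run w ι (r + i) u = A.run w' ι' (r + i) u := by
  induction i with
  | zero => exact h
  | succ i ih =>
    intro u hu
    have hu' : u ∉ S i := fun h => hu (hS i h)
    rw [← Nat.add_assoc, Algorithm.run, Algorithm.run, hw, hw']
    beta_reduce
    rw [ih u hu']
    congr 1
    funext x
    by_cases hx : x ∈ S i
    · simp [confine, hx, hu]
    · rw [ih x hx]

theorem containment_mono {V : Type} {S : ℕ → Set V} (hS : ∀ r, S r ⊆ S (r + 1)) {i j : ℕ}
    (h : i ≤ j) : S i ⊆ S j := monotone_nat_of_le_succ (f := S) hS h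

/-- In a round, the event `H` for the receivers outside `X` and no failure for those in `X`. -/
def fill {V : Type} (G H : Digraph V) (X : Set V) : Digraph V where
  Adj u v := (v ∈ X ∧ G.Adj u v) ∨ (v ∉ X ∧ H.Adj u v)

theorem fill_mem {V : Type} {G H : Digraph V} {f : ℕ} (hH : H ∈ boundedOmissions G f) (X : Set V) :
    fill G H X ∈ boundedOmissions G f := by
  refine ⟨fun u v h => ?_, le_trans (Set.encard_le_encard ?_) hH.2⟩
  · rcases h with h | h
    · exact h.2
    · exact hH.1 h.2
  · rintro ⟨u, v⟩ ⟨h1, h2⟩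
    simp only [fill] at h1 h2
    simp only [omissions, Set.mem_ofPred_eq]
    tauto

section LowerBound

variable {V : Type} {G : Digraph V} {f k : ℕ} {A : Algorithm V}

/-- Executions that differ, at time `r ≤ k`, only in the state of one node `b` end in the same
decisions if a containment of `b` leaves some node uninformed until time `k`. -/
theorem decided_eq_of_differ_at
    (hA : ∀ w ∈ mobileScheme (boundedOmissions G f), ∀ ι : V → Bool, A.ConsensusAt w ι k)
    {S : ℕ → Set V} (hS : IsContainment G f S) (hk : S k ≠ Set.univ) {r : ℕ} (hr : r ≤ k)
    {w w' : ℕ → Digraph V} (hw : w ∈ mobileScheme (boundedOmissions G f))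
    (hw' : w' ∈ mobileScheme (boundedOmissions G f)) {ι ι' : V → Bool}
    (h : ∀ u ∉ S 0, A.run w ι r u = A.run w' ι' r u) :
    A.decided (splice w r (confine G S)) ι k = A.decided (splice w' r (confine G S)) ι' k := by
  have hc : confine G S ∈ mobileScheme (boundedOmissions G f) := fun i => confine_mem hS i
  obtain ⟨u, hu⟩ := (Set.ne_univ_iff_exists_notMem _).1 hk
  have hu' : u ∉ S (k - r) := fun h => hu (containment_mono hS.mono (Nat.sub_le _ _) h)
  have key := A.run_eq_of_confine (G := G) hS.mono (ι := ι) (ι' := ι')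
    (fun i => splice_add w (confine G S) i r) (fun i => splice_add w' (confine G S) i r)
    (fun x hx => by
      rw [A.run_congr ι (fun i hi => splice_of_lt w (confine G S) hi),
        A.run_congr ι' (fun i hi => splice_of_lt w' (confine G S) hi), h x hx]) (k - r) u hu'
  rw [Nat.add_sub_cancel' hr] at key
  funext v
  rw [(hA _ (splice_mem hw hc r) ι).2.1 v u, (hA _ (splice_mem hw' hc r) ι').2.1 v u]
  simp only [Algorithm.decided, key]

/-- If no node can inform all others within `k` rounds, the decisions at time `k` depend on the
initial values alone. By backward induction on the round from which the scenarios may differ: the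
events of that round are exchanged by changing what one node receives at a time. -/
theorem decided_eq_of_agree [Finite V]
    (hA : ∀ w ∈ mobileScheme (boundedOmissions G f), ∀ ι : V → Bool, A.ConsensusAt w ι k)
    (hG : ∀ v, ∃ S, v ∈ S 0 ∧ IsContainment G f S ∧ S k ≠ Set.univ) (ι : V → Bool) (s : ℕ) :
    s ≤ k → ∀ w ∈ mobileScheme (boundedOmissions G f), ∀ w' ∈ mobileScheme (boundedOmissions G f),
      (∀ i < k - s, w i = w' i) → A.decided w ι k = A.decided w' ι k := by
  classical
  have := Fintype.ofFinite V
  induction s with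
  | zero =>
    intro _ w _ w' _ h
    funext v
    rw [Algorithm.decided, Algorithm.decided, A.run_congr (w' := w') ι (by simpa using h)]
  | succ s ih =>
    intro hs w hw w' hw' h
    set r := k - (s + 1) with hr
    have hr1 : k - s = r + 1 := by omega
    have hG' : ∀ H ∈ boundedOmissions G f, ∀ w ∈ mobileScheme (boundedOmissions G f),
        Function.update w r H ∈ mobileScheme (boundedOmissions G f) := by
      intro H hH w hw i
      by_cases hi : i = r
      · subst hi; simpa using hH
      · simpa [hi] using hw i
    have hfill : ∀ w ∈ mobileScheme (boundedOmissions G f),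
        A.decided w ι k = A.decided (Function.update w r G) ι k := by
      intro w hw
      have hX : ∀ X : Finset V, A.decided w ι k
          = A.decided (Function.update w r (fill G (w r) (X : Set V))) ι k := by
        intro X
        induction X using Finset.induction_on with
        | empty =>
          have : fill G (w r) ((∅ : Finset V) : Set V) = w r := by
            ext u v; simp [fill]
          rw [this, Function.update_eq_self]
        | insert b X hb ihX =>
          rw [ihX]
          obtain ⟨S, hbS, hS, hSk⟩ := hG b
          have hc : confine G S ∈ mobileScheme (boundedOmissions G f) := fun i => confine_mem hS i
          have m1 := hG' _ (fill_mem (hw r) (X : Set V)) w hw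
          have m2 := hG' _ (fill_mem (hw r) ((insert b X : Finset V) : Set V)) w hw
          have e := decided_eq_of_differ_at (ι := ι) (ι' := ι) hA hS hSk (r := r + 1)
            (by omega) m1 m2 (by
              intro u hu
              have hub : u ≠ b := fun h => hu (h ▸ hbS)
              have e1 : ∀ Y : Finset V,
                  A.run (Function.update w r (fill G (w r) (Y : Set V))) ι r = A.run w ι r :=
                fun Y => A.run_congr ι fun i hi => by simp [hi.ne]
              simp only [Algorithm.run, e1, Function.update_self]
              congr 1
              funext x
              simp [fill, hub])
          rw [ih (by omega) _ m1 _ (splice_mem m1 hc (r + 1))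
              (fun i hi => (splice_of_lt _ _ (by omega)).symm), e]
          exact (ih (by omega) _ m2 _ (splice_mem m2 hc (r + 1))
              (fun i hi => (splice_of_lt _ _ (by omega)).symm)).symm
      have h2 : fill G (w r) ((Finset.univ : Finset V) : Set V) = G := by
        ext u v; simp [fill]
      rw [hX Finset.univ, h2]
    rw [hfill w hw, hfill w' hw']
    have hGm : G ∈ boundedOmissions G f := by
      refine ⟨le_refl G, ?_⟩
      have : omissions G G = ∅ := by
        ext a; simp [omissions]
      simp [this]
    refine ih (by omega) _ (hG' _ hGm w hw) _ (hG' _ hGm w' hw') fun i hi => ?_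
    by_cases hir : i = r
    · subst hir; simp
    · simp [hir, h i (by omega)]

/-- Consensus in `k` rounds requires a node from which no `f` failures per round can withhold a
message from some node for `k` rounds. -/
theorem not_consensusSolvableIn [Finite V] [Nonempty V]
    (hG : ∀ v, ∃ S, v ∈ S 0 ∧ IsContainment G f S ∧ S k ≠ Set.univ) :
    ¬ ConsensusSolvableIn (mobileScheme (boundedOmissions G f)) k := by
  classical
  rintro ⟨A, -, hA⟩
  have := Fintype.ofFinite V
  have hw0 : ∃ w, w ∈ mobileScheme (boundedOmissions G f) := by
    obtain ⟨S, -, hS, -⟩ := hG (Classical.arbitrary V)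
    exact ⟨_, fun i => confine_mem hS i⟩
  obtain ⟨w, hw⟩ := hw0
  -- The initial values are switched from `false` to `true` one node at a time.
  have key : ∀ X : Finset V, A.decided w (fun _ => false) k
      = A.decided w (fun v => decide (v ∈ X)) k := by
    intro X
    induction X using Finset.induction_on with
    | empty => simp
    | insert b X hb ih =>
      rw [ih]
      obtain ⟨S, hbS, hS, hSk⟩ := hG b
      have hc : confine G S ∈ mobileScheme (boundedOmissions G f) := fun i => confine_mem hS i
      have m := splice_mem hw hc 0
      have e := decided_eq_of_differ_at (ι := fun v => decide (v ∈ X))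
        (ι' := fun v => decide (v ∈ insert b X)) hA hS hSk (Nat.zero_le k) hw hw (by
          intro u hu
          have hub : u ≠ b := fun h => hu (h ▸ hbS)
          simp [Algorithm.run, hub])
      rw [decided_eq_of_agree hA hG _ k le_rfl w hw _ m (by simp), e]
      exact (decided_eq_of_agree hA hG _ k le_rfl w hw _ m (by simp)).symm
  have h1 := (hA w hw (fun _ => false)).2.2 false (fun _ => rfl) (Classical.arbitrary V)
  have h2 := (hA w hw (fun v => decide (v ∈ (Finset.univ : Finset V)))).2.2 true (by simp)
    (Classical.arbitrary V)
  rw [key Finset.univ, h2] at h1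
  simp at h1

end LowerBound

/-- Over a finite set of nodes, an algorithm that always reaches Consensus does so within a bounded
number of rounds: the scenarios form a compact space, on which the time of decision is locally
bounded. -/
theorem consensusSolvableIn_of_consensusSolvable {V : Type} [Finite V] {R : Set (Digraph V)}
    (h : ConsensusSolvable (mobileScheme R)) : ∃ k, ConsensusSolvableIn (mobileScheme R) k := by
  classical
  obtain ⟨A, hirr, hA⟩ := h
  have hfin : Finite (Digraph V) :=
    Finite.of_injective (fun H : Digraph V => H.Adj) fun _ _ h => Digraph.ext h
  have hstep : ∀ w ∈ mobileScheme R, ∀ ι r, A.ConsensusAt w ι r → A.ConsensusAt w ι (r + 1) := by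
    intro w hw ι r h
    have hd : ∀ v, A.decided w ι (r + 1) v = A.decided w ι r v := by
      intro v
      obtain ⟨b, hb⟩ := h.1 v
      rw [hb, hirr w hw ι r v b hb]
    refine ⟨fun v => ?_, fun u v => ?_, fun b hb v => ?_⟩
    · rw [hd]; exact h.1 v
    · rw [hd, hd]; exact h.2.1 u v
    · rw [hd]; exact h.2.2 b hb v
  have hmono : ∀ w ∈ mobileScheme R, ∀ ι r s, r ≤ s → A.ConsensusAt w ι r →
      A.ConsensusAt w ι s := by
    intro w hw ι r s hrs h
    induction s, hrs using Nat.le_induction with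
    | base => exact h
    | succ s _ ih => exact hstep w hw ι s ih
  let _ : TopologicalSpace R := ⊥
  have : DiscreteTopology R := ⟨rfl⟩
  have hι : ∀ ι : V → Bool, ∃ r, ∀ w ∈ mobileScheme R, A.ConsensusAt w ι r := by
    intro ι
    suffices ∃ r, Set.univ ⊆ {w : ℕ → R | A.ConsensusAt (fun i => (w i : Digraph V)) ι r} by
      obtain ⟨r, hr⟩ := this
      exact ⟨r, fun w hw => hr (Set.mem_univ (fun i => (⟨w i, hw i⟩ : R)))⟩
    refine (isCompact_univ (X := ℕ → R)).elim_directed_cover _ ?_ ?_ ?_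
    · intro r
      rw [isOpen_iff_forall_mem_open]
      intro w hw
      refine ⟨⋂ i ∈ Finset.range r, {w' | w' i = w i}, ?_, ?_, by simp⟩
      · intro w' hw'
        simp only [Set.mem_iInter, Finset.mem_range, Set.mem_ofPred_eq] at hw'
        have e : A.decided (fun i => (w' i : Digraph V)) ι r
            = A.decided (fun i => (w i : Digraph V)) ι r := by
          funext v
          simp only [Algorithm.decided]
          rw [A.run_congr ι fun i hi => congrArg Subtype.val (hw' i hi)]
        simpa only [Set.mem_ofPred_eq, Algorithm.ConsensusAt, e] using hw
      · refine isOpen_biInter_finset fun i _ => ?_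
        have hc : Continuous fun w' : ℕ → R => w' i := continuous_apply i
        exact (isOpen_discrete {x : R | x = w i}).preimage hc
    · intro w _
      obtain ⟨r, hr⟩ := hA (fun i => (w i : Digraph V)) (fun i => (w i).2) ι
      exact Set.mem_iUnion.2 ⟨r, hr⟩
    · refine Monotone.directed_le fun r s hrs w hw => ?_
      exact hmono _ (fun i => (w i).2) ι r s hrs hw
  choose r hr using hι
  have := Fintype.ofFinite V
  refine ⟨Finset.univ.sup r, A, hirr, fun w hw ι => ?_⟩
  exact hmono w hw ι _ _ (Finset.le_sup (Finset.mem_univ ι)) (hr ι w hw)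

/-! ### Flooding and the upper bound -/

/-- The nodes informed by `s` after `r` rounds of flooding in the scenario `w`. -/
def informed {V : Type} (w : ℕ → Digraph V) (s : V) : ℕ → Set V
  | 0 => {s}
  | r + 1 => {v | v ∈ informed w s r ∨ ∃ u ∈ informed w s r, (w r).Adj u v}

theorem informed_isContainment {V : Type} {G : Digraph V} {f : ℕ} {w : ℕ → Digraph V}
    (hw : w ∈ mobileScheme (boundedOmissions G f)) (s : V) :
    IsContainment G f (informed w s) := by
  refine ⟨fun r v hv => Or.inl hv, fun r => le_trans (Set.encard_le_encard ?_) (hw r).2⟩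
  rintro ⟨u, v⟩ ⟨h1, h2, h3⟩
  exact ⟨h1, fun h => h3 (Or.inr ⟨u, h2, h⟩)⟩

open Classical in
/-- The algorithm in which the initial value of `s` is flooded for `k` rounds and then decided.
A state consists of the number of rounds so far and the value of `s`, if it is known. -/
noncomputable def flooding {V : Type} (s : V) (k : ℕ) : Algorithm V where
  State := ℕ × Option Bool
  Msg := Bool
  init v b := (0, if v = s then some b else none)
  send _ x _ := x.2
  step _ x m := (x.1 + 1,
    if x.2.isSome then x.2
    else if ∃ u, m u = some true then some true
    else if ∃ u, m u = some false then some false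
    else none)
  decision _ x := if k ≤ x.1 then x.2 else none

open Classical in
theorem flooding_run {V : Type} (s : V) (k : ℕ) (w : ℕ → Digraph V) (ι : V → Bool) (r : ℕ) (v : V) :
    (flooding s k).run w ι r v = (r, if v ∈ informed w s r then some (ι s) else none) := by
  induction r generalizing v with
  | zero =>
    by_cases h : v = s
    · subst h; simp [Algorithm.run, flooding, informed]
    · simp [Algorithm.run, flooding, informed, h]
  | succ r ih =>
    simp only [Algorithm.run, ih]
    by_cases h : v ∈ informed w s r
    · simp [flooding, informed, h]
    · by_cases h' : ∃ u ∈ informed w s r, (w r).Adj u v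
      · obtain ⟨u, hu, huv⟩ := h'
        have e1 : v ∈ informed w s (r + 1) := Or.inr ⟨u, hu, huv⟩
        cases hb : ι s
        · have : ¬ ∃ x, (if (w r).Adj x v then
              (if x ∈ informed w s r then some (ι s) else none) else none) = some true := by
            rintro ⟨x, hx⟩
            split_ifs at hx
            simp [hb] at hx
          simp only [hb] at this
          simp only [flooding, h, e1, if_true, if_false, this]
          simp only [Option.isSome_none, Bool.false_eq_true, if_false, Prod.mk.injEq, true_and]
          rw [if_pos ⟨u, by simp [huv, hu]⟩]
        · simp only [flooding, h, e1, if_true, if_false]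
          simp only [Option.isSome_none, Bool.false_eq_true, if_false, Prod.mk.injEq, true_and]
          rw [if_pos ⟨u, by simp [huv, hu]⟩]
      · have e1 : v ∉ informed w s (r + 1) := fun hv => hv.elim h h'
        have : ∀ b, ¬ ∃ x, (if (w r).Adj x v then
            (if x ∈ informed w s r then some (ι s) else none) else none) = some b := by
          rintro b ⟨x, hx⟩
          split_ifs at hx with h1 h2
          exact h' ⟨x, h2, h1⟩
        simp only [flooding, h, e1, if_false, this]
        simp

/-- Consensus is solvable in `k` rounds if a message from some node `s` reaches all nodes within
`k` rounds, whatever the failures. -/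
theorem consensusSolvableIn_of_forall_containment {V : Type} {G : Digraph V} {f k : ℕ} (s : V)
    (h : ∀ S, s ∈ S 0 → IsContainment G f S → S k = Set.univ) :
    ConsensusSolvableIn (mobileScheme (boundedOmissions G f)) k := by
  classical
  refine ⟨flooding s k, ?_, ?_⟩
  · intro w hw ι r v b hb
    have e : ∀ r, (flooding s k).decided w ι r v
        = if k ≤ r then (if v ∈ informed w s r then some (ι s) else none) else none := by
      intro r
      simp only [Algorithm.decided, flooding_run]
      rfl
    rw [e] at hb ⊢
    split_ifs at hb with h1 h2
    have h3 : v ∈ informed w s (r + 1) := Or.inl h2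
    rw [if_pos (by omega), if_pos h3, hb]
  · intro w hw ι
    have hk := h _ rfl (informed_isContainment hw s)
    have e : ∀ v, (flooding s k).decided w ι k v = some (ι s) := by
      intro v
      simp only [Algorithm.decided, flooding_run]
      simp [flooding, hk]
    refine ⟨fun v => ⟨_, e v⟩, fun u v => by rw [e, e], fun b hb v => ?_⟩
    rw [e, hb]

/-! ### Polarization -/

section Polarization

variable {V : Type}

/-- The polarization of `S` by an involution `τ` towards the half `H`: where `S` holds exactly one
of `x` and `τ x`, it is replaced by the one in `H`. -/
def polarize (τ : V → V) (H : V → Prop) (S : Set V) : Set V :=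
  {x | (x ∈ S ∧ τ x ∈ S) ∨ (H x ∧ (x ∈ S ∨ τ x ∈ S))}

/-- `τ` is an involutive automorphism of `G` and `H` contains one node of each non-trivial orbit; an
edge between two non-trivial orbits stays within `H` or within its complement. -/
structure IsReflection (G : Digraph V) (τ : V → V) (H : V → Prop) : Prop where
  invol : ∀ x, τ (τ x) = x
  adj : ∀ x y, G.Adj x y → G.Adj (τ x) (τ y)
  half : ∀ x, τ x ≠ x → (H (τ x) ↔ ¬ H x)
  cross : ∀ x y, G.Adj x y → τ x ≠ x → τ y ≠ y → y ≠ τ x → (H x ↔ H y)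

theorem polarize_mono {τ : V → V} {H : V → Prop} {S S' : Set V} (h : S ⊆ S') :
    polarize τ H S ⊆ polarize τ H S' := by
  rintro x (⟨h1, h2⟩ | ⟨h1, h2⟩)
  · exact Or.inl ⟨h h1, h h2⟩
  · exact Or.inr ⟨h1, h2.imp (@h _) (@h _)⟩

open Classical in
/-- Over an orbit of arcs, polarization does not increase the number of leaking arcs. -/
theorem leak_polarize_orbit {G : Digraph V} {τ : V → V} {H : V → Prop} (hτ : IsReflection G τ H)
    {S S' : Set V} (h : S ⊆ S') {x y : V} (hxy : G.Adj x y) :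
    (if x ∈ polarize τ H S ∧ y ∉ polarize τ H S' then 1 else 0) +
      (if τ x ∈ polarize τ H S ∧ τ y ∉ polarize τ H S' then 1 else 0) ≤
    (if x ∈ S ∧ y ∉ S' then 1 else 0) + (if τ x ∈ S ∧ τ y ∉ S' then 1 else 0) := by
  have ix := hτ.invol x
  have iy := hτ.invol y
  simp only [polarize, Set.mem_ofPred_eq, ix, iy]
  by_cases fx : τ x = x
  · simp only [fx]
    by_cases fy : τ y = y
    · simp only [fy]
      by_cases x ∈ S <;> by_cases y ∈ S' <;> by_cases H x <;> by_cases H y <;> simp_all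
    · have := hτ.half y fy
      by_cases x ∈ S <;> by_cases y ∈ S' <;> by_cases τ y ∈ S' <;> by_cases H x <;>
        by_cases H y <;> simp_all
  · have hx := hτ.half x fx
    by_cases fy : τ y = y
    · simp only [fy]
      by_cases x ∈ S <;> by_cases τ x ∈ S <;> by_cases y ∈ S' <;> by_cases H x <;>
        by_cases H y <;> simp_all
    · have hy := hτ.half y fy
      by_cases e : y = τ x
      · subst e
        simp only [ix]
        have h1 := @h x
        have h2 := @h (τ x)
        by_cases x ∈ S <;> by_cases τ x ∈ S <;> by_cases x ∈ S' <;> by_cases τ x ∈ S' <;>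
          by_cases H x <;> simp_all
      · have hc := hτ.cross x y hxy fx fy e
        by_cases x ∈ S <;> by_cases τ x ∈ S <;> by_cases y ∈ S' <;> by_cases τ y ∈ S' <;>
          by_cases H x <;> simp_all

open Classical in
theorem leak_polarize_le [Finite V] {G : Digraph V} {τ : V → V} {H : V → Prop}
    (hτ : IsReflection G τ H) {S S' : Set V} (h : S ⊆ S') :
    (leak G (polarize τ H S) (polarize τ H S')).encard ≤ (leak G S S').encard := by
  have := Fintype.ofFinite V
  -- the number of leaking arcs as a sum, which is then symmetrized over `τ`
  have card_eq : ∀ P P' : Set V, (leak G P P').encard = ((∑ a : V × V with G.Adj a.1 a.2,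
      if a.1 ∈ P ∧ a.2 ∉ P' then 1 else 0 : ℕ) : ℕ∞) := by
    intro P P'
    rw [← Finset.sum_filter, Finset.sum_const, smul_eq_mul, mul_one, Finset.filter_filter,
      ← Set.encard_coe_eq_coe_finsetCard]
    congr 1
    ext a
    simp [leak]
  have symm : ∀ P P' : Set V, (∑ a : V × V with G.Adj a.1 a.2,
      if a.1 ∈ P ∧ a.2 ∉ P' then 1 else 0 : ℕ) = ∑ a : V × V with G.Adj a.1 a.2,
      if τ a.1 ∈ P ∧ τ a.2 ∉ P' then 1 else 0 := by
    intro P P'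
    refine Finset.sum_nbij' (fun a => (τ a.1, τ a.2)) (fun a => (τ a.1, τ a.2)) ?_ ?_ ?_ ?_ ?_
    · intro a ha
      simp only [Finset.mem_filter, Finset.mem_univ, true_and] at ha ⊢
      exact hτ.adj _ _ ha
    · intro a ha
      simp only [Finset.mem_filter, Finset.mem_univ, true_and] at ha ⊢
      exact hτ.adj _ _ ha
    · intro a _; simp [hτ.invol]
    · intro a _; simp [hτ.invol]
    · intro a _; simp [hτ.invol]
  rw [card_eq, card_eq]
  have key := Finset.sum_le_sum (s := Finset.univ.filter fun a : V × V => G.Adj a.1 a.2)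
    fun a ha => leak_polarize_orbit hτ h (Finset.mem_filter.1 ha).2
  rw [Finset.sum_add_distrib, Finset.sum_add_distrib, ← symm, ← symm] at key
  exact_mod_cast (by omega)

theorem IsContainment.polarize [Finite V] {G : Digraph V} {f : ℕ} {S : ℕ → Set V}
    (hS : IsContainment G f S) {τ : V → V} {H : V → Prop} (hτ : IsReflection G τ H) :
    IsContainment G f fun r => polarize τ H (S r) :=
  ⟨fun r => polarize_mono (hS.mono r),
    fun r => (leak_polarize_le hτ (hS.mono r)).trans (hS.leak_le r)⟩

open Classical in
/-- If `H` holds the lighter node of each non-trivial orbit, then polarization does not increase the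
weight of a set. -/
theorem sum_polarize_le [Fintype V] {G : Digraph V} {τ : V → V} {H : V → Prop}
    (hτ : IsReflection G τ H) {wt : V → ℕ} (hwt : ∀ x, τ x ≠ x → H x → wt x < wt (τ x))
    (S : Set V) :
    (∑ x, if x ∈ polarize τ H S then wt x else 0) ≤ ∑ x, (if x ∈ S then wt x else 0) ∧
    ((∃ x ∈ S, τ x ∉ S ∧ H (τ x)) →
      (∑ x, if x ∈ polarize τ H S then wt x else 0) < ∑ x, (if x ∈ S then wt x else 0)) := by
  have symm : ∀ P : Set V, (∑ x, if x ∈ P then wt x else 0)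
      = ∑ x, if τ x ∈ P then wt (τ x) else 0 := fun P =>
    (Equiv.sum_comp (Function.Involutive.toPerm τ hτ.invol)
      (fun x => if x ∈ P then wt x else 0)).symm
  have dbl : ∀ P : Set V, 2 * (∑ x, if x ∈ P then wt x else 0)
      = ∑ x, ((if x ∈ P then wt x else 0) + if τ x ∈ P then wt (τ x) else 0) := by
    intro P
    rw [Finset.sum_add_distrib, ← symm]
    ring
  have hle : ∀ x, ((if x ∈ polarize τ H S then wt x else 0)
      + if τ x ∈ polarize τ H S then wt (τ x) else 0) ≤
      (if x ∈ S then wt x else 0) + if τ x ∈ S then wt (τ x) else 0 := by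
    intro x
    have ix := hτ.invol x
    simp only [polarize, Set.mem_ofPred_eq, ix]
    by_cases fx : τ x = x
    · simp only [fx]
      by_cases x ∈ S <;> by_cases H x <;> simp_all
    · have hx := hτ.half x fx
      have h1 := hwt x fx
      have h2 := hwt (τ x) (by rw [ix]; exact fun h => fx h.symm)
      rw [ix] at h2
      clear hwt
      by_cases x ∈ S <;> by_cases τ x ∈ S <;> by_cases hH : H x <;> simp_all <;> omega
  refine ⟨?_, ?_⟩
  · have := Finset.sum_le_sum (s := Finset.univ) fun x _ => hle x
    rw [← dbl, ← dbl] at this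
    omega
  · rintro ⟨x, hx, hx', hH⟩
    have fx : τ x ≠ x := fun h => hx' (by rwa [h])
    have ix := hτ.invol x
    have := Finset.sum_lt_sum (s := Finset.univ) (fun x _ => hle x) ⟨x, Finset.mem_univ x, by
      have h0 := hτ.half x fx
      have h2 := hwt (τ x) (by rw [ix]; exact fun h => fx h.symm)
      rw [ix] at h2
      simp only [polarize, Set.mem_ofPred_eq, ix]
      simp_all⟩
    rw [← dbl, ← dbl] at this
    omega

end Polarization

/-! ### The hypercube as the graph of subsets -/

/-- The hypercube whose vertices are the subsets of `α`. -/
def cube (α : Type) [DecidableEq α] : Digraph (Finset α) where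
  Adj x y := (symmDiff x y).card = 1

/-- The set of the coordinates in which `x` differs from `v`. -/
def offset {n : ℕ} (v x : Fin n → Bool) : Finset (Fin n) := Finset.univ.filter fun i => x i ≠ v i

theorem offset_self {n : ℕ} (v : Fin n → Bool) : offset v v = ∅ := by simp [offset]

theorem offset_bijective {n : ℕ} (v : Fin n → Bool) : Function.Bijective (offset v) := by
  rw [Fintype.bijective_iff_injective_and_card]
  refine ⟨fun x y h => ?_, by simp⟩
  funext i
  have := congrArg (i ∈ ·) h
  simp only [offset, Finset.mem_filter, Finset.mem_univ, true_and, eq_iff_iff] at this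
  revert this
  cases x i <;> cases y i <;> cases v i <;> simp

theorem cube_adj_offset {n : ℕ} (v x y : Fin n → Bool) :
    (cube (Fin n)).Adj (offset v x) (offset v y) ↔ (hypercube n).Adj x y := by
  have : symmDiff (offset v x) (offset v y) = Finset.univ.filter fun i => x i ≠ y i := by
    ext i
    simp only [offset, Finset.mem_symmDiff, Finset.mem_filter, Finset.mem_univ, true_and]
    cases x i <;> cases y i <;> cases v i <;> simp
  simp only [cube, hypercube, this, hammingDist]

/-- Containments are transported along isomorphisms. -/
theorem IsContainment.preimage {V W : Type} {G : Digraph V} {G' : Digraph W} {e : V → W}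
    (he : Function.Bijective e) (hG : ∀ x y, G'.Adj (e x) (e y) ↔ G.Adj x y) {f : ℕ}
    {S : ℕ → Set W} (hS : IsContainment G' f S) : IsContainment G f fun r => e ⁻¹' S r := by
  refine ⟨fun r => Set.preimage_mono (hS.mono r), fun r => le_trans ?_ (hS.leak_le r)⟩
  refine Set.encard_le_encard_of_injOn (f := Prod.map e e) ?_ (he.1.prodMap he.1).injOn
  rintro ⟨x, y⟩ ⟨h1, h2, h3⟩
  exact ⟨(hG x y).2 h1, h2, h3⟩

theorem cube_adj_iff {α : Type} [DecidableEq α] {x y : Finset α} :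
    (cube α).Adj x y ↔ ∃ c, (c ∉ x ∧ y = insert c x) ∨ (c ∉ y ∧ x = insert c y) := by
  simp only [cube, Finset.card_eq_one]
  constructor
  · rintro ⟨c, hc⟩
    refine ⟨c, ?_⟩
    have hm : ∀ a, a ∈ symmDiff x y ↔ a = c := fun a => by rw [hc, Finset.mem_singleton]
    simp only [Finset.mem_symmDiff] at hm
    by_cases h : c ∈ x
    · right
      have h' : c ∉ y := by have := hm c; tauto
      refine ⟨h', ?_⟩
      ext a
      have := hm a
      rw [Finset.mem_insert]
      by_cases ha : a = c
      · subst ha; tauto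
      · tauto
    · left
      refine ⟨h, ?_⟩
      ext a
      have := hm a
      rw [Finset.mem_insert]
      by_cases ha : a = c
      · subst ha; tauto
      · tauto
  · rintro ⟨c, ⟨h, rfl⟩ | ⟨h, rfl⟩⟩
    · refine ⟨c, ?_⟩
      ext a
      simp only [Finset.mem_symmDiff, Finset.mem_insert, Finset.mem_singleton]
      by_cases ha : a = c
      · subst ha; tauto
      · tauto
    · refine ⟨c, ?_⟩
      ext a
      simp only [Finset.mem_symmDiff, Finset.mem_insert, Finset.mem_singleton]
      by_cases ha : a = c
      · subst ha; tauto
      · tauto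

/-! ### Compression -/

theorem isReflection_flip {α : Type} [DecidableEq α] (c : α) :
    IsReflection (cube α) (fun x => symmDiff x {c}) (fun x => c ∉ x) where
  invol x := by simp
  adj x y h := by
    have : symmDiff (symmDiff x {c}) (symmDiff y {c}) = symmDiff x y := by
      rw [symmDiff_comm y, symmDiff_assoc, symmDiff_symmDiff_cancel_left]
    simpa only [cube, this] using h
  half x _ := by simp [Finset.mem_symmDiff]
  cross x y h _ _ hne := by
    by_contra hc
    obtain ⟨d, hd⟩ := Finset.card_eq_one.1 h
    have h1 : c ∈ symmDiff x y := by
      rw [Finset.mem_symmDiff]; tauto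
    rw [hd, Finset.mem_singleton] at h1
    apply hne
    rw [h1, ← hd, symmDiff_symmDiff_cancel_left]

theorem mem_map_swap {α : Type} [DecidableEq α] {i j a : α} {x : Finset α} :
    a ∈ x.map (Equiv.swap i j).toEmbedding ↔ Equiv.swap i j a ∈ x := by
  rw [Finset.mem_map_equiv, Equiv.symm_swap]

theorem isReflection_swap {α : Type} [DecidableEq α] {i j : α} (hij : i ≠ j) :
    IsReflection (cube α) (fun x => x.map (Equiv.swap i j).toEmbedding)
      (fun x => i ∈ x ∧ j ∉ x) := by
  have fix : ∀ x : Finset α, x.map (Equiv.swap i j).toEmbedding ≠ x → ¬ (i ∈ x ↔ j ∈ x) := by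
    intro x hx h
    apply hx
    ext a
    rw [mem_map_swap]
    by_cases hi : a = i
    · subst hi; simp [h]
    · by_cases hj : a = j
      · subst hj; simp [h]
      · rw [Equiv.swap_apply_of_ne_of_ne hi hj]
  refine ⟨fun x => ?_, fun x y h => ?_, fun x hx => ?_, fun x y h hx hy _ => ?_⟩
  · ext a; simp
  · have : symmDiff (x.map (Equiv.swap i j).toEmbedding) (y.map (Equiv.swap i j).toEmbedding)
        = (symmDiff x y).map (Equiv.swap i j).toEmbedding := by
      ext a; simp only [Finset.mem_symmDiff, mem_map_swap]
    simpa only [cube, this, Finset.card_map] using h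
  · have := fix x hx
    simp only [mem_map_swap, Equiv.swap_apply_left, Equiv.swap_apply_right]
    tauto
  · have h1 := fix x hx
    have h2 := fix y hy
    by_contra hc
    have hi : i ∈ symmDiff x y := by rw [Finset.mem_symmDiff]; tauto
    have hj : j ∈ symmDiff x y := by rw [Finset.mem_symmDiff]; tauto
    exact hij (Finset.card_le_one.1 (le_of_eq h) i hi j hj)

/-- A compressed containment of the source `∅` that withholds the message from the antipode of the
source until time `T`: its sets are closed under removing elements, and under replacing an element
by a smaller one. -/
structure IsCompressed {n : ℕ} (f T : ℕ) (S : ℕ → Set (Finset (Fin n))) : Prop where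
  cont : IsContainment (cube (Fin n)) f S
  empty_mem : ∅ ∈ S 0
  univ_notMem : Finset.univ ∉ S T
  down : ∀ r ≤ T, ∀ x ∈ S r, ∀ y ⊆ x, y ∈ S r
  shift : ∀ r ≤ T, ∀ x ∈ S r, ∀ a j, a < j → j ∈ x → a ∉ x → insert a (x.erase j) ∈ S r

open Classical in
/-- If a message from `∅` can be withheld from some vertex until time `T`, this can be done by a
compressed containment. A polarization that is not symmetric about the uninformed vertex moves that
vertex further from the source, so it may be taken to be the antipode; then a containment of least
weight is fixed by all polarizations. -/
theorem exists_isCompressed {n f T : ℕ} {S : ℕ → Set (Finset (Fin n))}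
    (hS : IsContainment (cube (Fin n)) f S) (h0 : ∅ ∈ S 0) (hT : S T ≠ Set.univ) :
    ∃ S' : ℕ → Set (Finset (Fin n)), IsCompressed f T S' := by
  -- an uninformed vertex of maximal size is the antipode
  have h1 : ∃ S : ℕ → Set (Finset (Fin n)), IsContainment (cube (Fin n)) f S ∧ ∅ ∈ S 0 ∧
      Finset.univ ∉ S T := by
    obtain ⟨u, hu⟩ := (Set.ne_univ_iff_exists_notMem _).1 hT
    induction hk : (Finset.univ \ u).card generalizing S u with
    | zero =>
      rw [Finset.card_eq_zero, Finset.sdiff_eq_empty_iff_subset, Finset.univ_subset_iff] at hk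
      exact ⟨S, hS, h0, hk ▸ hu⟩
    | succ k ih =>
      obtain ⟨c, hc⟩ : (Finset.univ \ u).Nonempty := Finset.card_pos.1 (by omega)
      have hcu : c ∉ u := (Finset.mem_sdiff.1 hc).2
      have e : symmDiff (insert c u) {c} = u := by
        ext a
        simp only [Finset.mem_symmDiff, Finset.mem_insert, Finset.mem_singleton]
        by_cases ha : a = c
        · subst ha; tauto
        · tauto
      have hn : insert c u ∉ polarize (fun x => symmDiff x {c}) (fun x => c ∉ x) (S T) := by
        simp [polarize, e, hu]
      refine ih (hS.polarize (isReflection_flip c)) ?_ ?_ _ hn ?_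
      · simp [polarize, h0]
      · exact (Set.ne_univ_iff_exists_notMem _).2 ⟨_, hn⟩
      · rw [Finset.sdiff_insert, Finset.card_erase_of_mem hc, hk]; rfl
  let wt : Finset (Fin n) → ℕ := fun x => ∑ c ∈ x, ((c : ℕ) + 1)
  let W : (ℕ → Set (Finset (Fin n))) → ℕ := fun S =>
    ∑ r ∈ Finset.range (T + 1), ∑ x, if x ∈ S r then wt x else 0
  obtain ⟨S', ⟨hS', h0', hT'⟩, hmin⟩ := WellFounded.has_min (measure W).wf
    {S | IsContainment (cube (Fin n)) f S ∧ ∅ ∈ S 0 ∧ Finset.univ ∉ S T} h1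
  -- a set of the minimal containment holds with `x` every lighter reflection of `x`
  have key : ∀ (τ : Finset (Fin n) → Finset (Fin n)) (H : Finset (Fin n) → Prop),
      IsReflection (cube (Fin n)) τ H → (∀ x, τ x ≠ x → H x → wt x < wt (τ x)) →
      (τ ∅ = ∅ ∨ H ∅) → (τ Finset.univ = Finset.univ ∨ ¬ H Finset.univ) →
      ∀ r ≤ T, ∀ x ∈ S' r, H (τ x) → τ x ∈ S' r := by
    intro τ H hτ hwt he hu r hr x hx hH
    by_contra hx'
    refine hmin (fun r => polarize τ H (S' r)) ⟨hS'.polarize hτ, ?_, ?_⟩ ?_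
    · rcases he with he | he
      · exact Or.inl ⟨h0', by rw [he]; exact h0'⟩
      · exact Or.inr ⟨he, Or.inl h0'⟩
    · rintro (⟨h, -⟩ | ⟨h, h'⟩)
      · exact hT' h
      · rcases hu with hu | hu
        · rw [hu, or_self] at h'
          exact hT' h'
        · exact hu h
    · exact Finset.sum_lt_sum (fun r _ => (sum_polarize_le hτ hwt (S' r)).1)
        ⟨r, Finset.mem_range.2 (by omega), (sum_polarize_le hτ hwt (S' r)).2 ⟨x, hx, hx', hH⟩⟩
  refine ⟨S', hS', h0', hT', ?_, ?_⟩
  · intro r hr x hx y hy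
    have step : ∀ x ∈ S' r, ∀ c ∈ x, x.erase c ∈ S' r := by
      intro x hx c hc
      have e : symmDiff x {c} = x.erase c := by
        ext a
        simp only [Finset.mem_symmDiff, Finset.mem_erase, Finset.mem_singleton]
        by_cases ha : a = c
        · subst ha; tauto
        · tauto
      have := key _ _ (isReflection_flip c) ?_ (Or.inr (by simp)) (Or.inr (by simp)) r hr x hx
        (by simp [e])
      · rwa [e] at this
      · intro x _ hcx
        have : symmDiff x {c} = insert c x := by
          ext a
          simp only [Finset.mem_symmDiff, Finset.mem_insert, Finset.mem_singleton]
          by_cases ha : a = c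
          · subst ha; tauto
          · tauto
        simp only [this, wt, Finset.sum_insert hcx]
        omega
    have : ∀ z : Finset (Fin n), x \ z ∈ S' r := by
      intro z
      induction z using Finset.induction_on with
      | empty => simpa using hx
      | insert c z _ ih =>
        rw [Finset.sdiff_insert]
        by_cases hc : c ∈ x \ z
        · exact step _ ih c hc
        · rwa [Finset.erase_eq_of_notMem hc]
    have := this (x \ y)
    rwa [Finset.sdiff_sdiff_eq_self hy] at this
  · intro r hr x hx a j haj hj ha
    have e : x.map (Equiv.swap a j).toEmbedding = insert a (x.erase j) := by
      ext b
      rw [mem_map_swap, Finset.mem_insert, Finset.mem_erase]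
      by_cases h1 : b = a
      · subst h1; simp [hj]
      · by_cases h2 : b = j
        · subst h2; simp [ha, h1]
        · rw [Equiv.swap_apply_of_ne_of_ne h1 h2]; tauto
    have := key _ _ (isReflection_swap haj.ne) ?_ (Or.inl (by simp)) (Or.inl (by simp)) r hr x hx
      (by rw [e]; simp [haj.ne'])
    · rwa [e] at this
    · rintro y - ⟨h1, h2⟩
      simp only [wt, Finset.sum_map, Equiv.coe_toEmbedding]
      rw [← Finset.add_sum_erase _ _ h1, ← Finset.add_sum_erase _ _ h1, Equiv.swap_apply_left]
      have : ∑ x ∈ y.erase a, (((Equiv.swap a j) x : ℕ) + 1) = ∑ x ∈ y.erase a, ((x : ℕ) + 1) := by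
        refine Finset.sum_congr rfl fun b hb => ?_
        rw [Finset.mem_erase] at hb
        rw [Equiv.swap_apply_of_ne_of_ne hb.1 (fun h => h2 (by rw [← h]; exact hb.2))]
      rw [this]
      have : (a : ℕ) < j := haj
      omega

/-- The dual of a containment: the complements of the vertices that are uninformed at time `T - r`.
Complementation exchanges source and antipode, and the reversal of time turns the leaking arcs
around. After time `T` it contains all vertices. -/
def dual {n : ℕ} (T : ℕ) (S : ℕ → Set (Finset (Fin n))) (r : ℕ) : Set (Finset (Fin n)) :=
  {x | r ≤ T → xᶜ ∉ S (T - r)}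

theorem IsCompressed.dual {n f T : ℕ} {S : ℕ → Set (Finset (Fin n))} (hS : IsCompressed f T S) :
    IsCompressed f T (dual T S) where
  cont := by
    refine ⟨fun r x hx hr h => hx (by omega) ?_, fun r => ?_⟩
    · exact containment_mono hS.cont.mono (by omega) h
    · by_cases hr : r < T
      · refine le_trans ?_ (hS.cont.leak_le (T - (r + 1)))
        refine Set.encard_le_encard_of_injOn (f := fun a => (a.2ᶜ, a.1ᶜ)) ?_ ?_
        · rintro ⟨x, y⟩ ⟨h1, h2, h3⟩
          simp only [MobileOmission.dual, Set.mem_ofPred_eq, Classical.not_imp, not_not] at h2 h3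
          refine ⟨?_, h3.2, ?_⟩
          · have : symmDiff yᶜ xᶜ = symmDiff x y := by
              ext a; simp only [Finset.mem_symmDiff, Finset.mem_compl]; tauto
            simpa only [cube, this] using h1
          · rw [show T - (r + 1) + 1 = T - r by omega]
            exact h2 hr.le
        · rintro ⟨x, y⟩ - ⟨x', y'⟩ - h
          simp only [Prod.mk.injEq, compl_inj_iff] at h
          rw [h.1, h.2]
      · have : leak (cube (Fin n)) (MobileOmission.dual T S r) (MobileOmission.dual T S (r + 1))
            = ∅ := by
          ext a
          simp only [leak, MobileOmission.dual, Set.mem_ofPred_eq, Set.mem_empty_iff_false,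
            iff_false]
          rintro ⟨-, -, h⟩
          exact h fun h' => absurd h' (by omega)
        simp [this]
  empty_mem := by simpa [MobileOmission.dual] using hS.univ_notMem
  univ_notMem := by simpa [MobileOmission.dual] using hS.empty_mem
  down r hr x hx y hy hr' h :=
    hx hr' (hS.down _ (by omega) _ h _ (Finset.compl_subset_compl.2 hy))
  shift r hr x hx a j haj hj ha hr' h := by
    refine hx hr' ?_
    have := hS.shift _ (by omega) _ h a j haj (by simp [haj.ne']) (by simp)
    convert this using 1
    ext b
    simp only [Finset.mem_compl, Finset.mem_insert, Finset.mem_erase]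
    by_cases h1 : b = a
    · subst h1; simp [ha]
    · by_cases h2 : b = j
      · subst h2; simp [hj, h1]
      · simp [h1, h2]

/-! ### The flow inequality -/

section Flow

variable {α : Type} [DecidableEq α] [Fintype α]

open Classical in
/-- The arcs from `u` to `insert d u`, written as pairs `(u, d)`, that leak in round `r`. -/
noncomputable def blocked (S : ℕ → Set (Finset α)) (r : ℕ) : Finset (Finset α × α) :=
  Finset.univ.filter fun p => p.2 ∉ p.1 ∧ p.1 ∈ S r ∧ insert p.2 p.1 ∉ S (r + 1)

theorem mem_blocked {S : ℕ → Set (Finset α)} {r : ℕ} {p : Finset α × α} :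
    p ∈ blocked S r ↔ p.2 ∉ p.1 ∧ p.1 ∈ S r ∧ insert p.2 p.1 ∉ S (r + 1) := by
  simp [blocked]

theorem card_blocked_le {f : ℕ} {S : ℕ → Set (Finset α)} (hS : IsContainment (cube α) f S) (r : ℕ) :
    (blocked S r).card ≤ f := by
  have h := hS.leak_le r
  have h2 : ((blocked S r : Set (Finset α × α))).encard
      ≤ (leak (cube α) (S r) (S (r + 1))).encard := by
    refine Set.encard_le_encard_of_injOn (f := fun p => (p.1, insert p.2 p.1)) ?_ ?_
    · rintro ⟨u, d⟩ hp
      have hp := mem_blocked.1 (Finset.mem_coe.1 hp)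
      exact ⟨cube_adj_iff.2 ⟨d, Or.inl ⟨hp.1, rfl⟩⟩, hp.2⟩
    · rintro ⟨u, d⟩ hp ⟨u', d'⟩ hp' h
      have hp := mem_blocked.1 (Finset.mem_coe.1 hp)
      have hp' := mem_blocked.1 (Finset.mem_coe.1 hp')
      simp only [Prod.mk.injEq] at h hp hp' ⊢
      obtain ⟨rfl, h⟩ := h
      refine ⟨rfl, ?_⟩
      have : d ∈ insert d' u := h ▸ Finset.mem_insert_self d u
      exact (Finset.mem_insert.1 this).resolve_right hp.1
  rw [Set.encard_coe_eq_coe_finsetCard] at h2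
  exact_mod_cast h2.trans h

open Classical in
/-- The members of `S r` at height `j` in the interval from `x` to `y`. -/
noncomputable def level (x y : Finset α) (S : ℕ → Set (Finset α)) (r j : ℕ) : Finset (Finset α) :=
  Finset.univ.filter fun u => u ∈ S r ∧ x ⊆ u ∧ u ⊆ y ∧ (u \ x).card = j

/-- Double counting of the arcs that leave a level of the interval from `x` to `y` upwards. -/
theorem card_level_mul_le {x y : Finset α} (hxy : x ⊆ y) {N : ℕ} (hN : (y \ x).card = N)
    (S : ℕ → Set (Finset α)) (r j : ℕ) :
    (level x y S r j).card * (N - j) ≤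
      ((blocked S r).filter fun p => x ⊆ p.1 ∧ insert p.2 p.1 ⊆ y ∧ (p.1 \ x).card = j).card +
      (level x y S (r + 1) (j + 1)).card * (j + 1) := by
  classical
  set P := (level x y S r j).sigma fun u => y \ u with hP
  set Q := (level x y S (r + 1) (j + 1)).sigma fun v => v \ x with hQ
  have hPc : P.card = (level x y S r j).card * (N - j) := by
    rw [hP, Finset.card_sigma, Finset.sum_const_nat]
    intro u hu
    simp only [level, Finset.mem_filter, Finset.mem_univ, true_and] at hu
    rw [Finset.card_sdiff_of_subset hu.2.2.1]
    have h1 := hu.2.2.2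
    rw [Finset.card_sdiff_of_subset hu.2.1] at h1
    rw [Finset.card_sdiff_of_subset hxy] at hN
    have := Finset.card_le_card hu.2.1
    have := Finset.card_le_card hu.2.2.1
    omega
  have hQc : Q.card = (level x y S (r + 1) (j + 1)).card * (j + 1) := by
    rw [hQ, Finset.card_sigma, Finset.sum_const_nat]
    intro v hv
    simp only [level, Finset.mem_filter, Finset.mem_univ, true_and] at hv
    exact hv.2.2.2
  rw [← hPc, ← hQc, ← Finset.card_filter_add_card_filter_not (s := P)
    (fun a => insert a.2 a.1 ∉ S (r + 1))]
  refine add_le_add ?_ ?_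
  · refine Finset.card_le_card_of_injOn (fun a => (a.1, a.2)) ?_ ?_
    · rintro ⟨u, d⟩ h
      simp only [hP, level, Finset.coe_filter, Finset.mem_sigma, Finset.mem_filter,
        Finset.mem_univ, true_and, Finset.mem_sdiff, Set.mem_ofPred_eq] at h
      simp only [Finset.coe_filter, Set.mem_ofPred_eq, mem_blocked]
      exact ⟨⟨h.1.2.2, h.1.1.1, h.2⟩, h.1.1.2.1, Finset.insert_subset h.1.2.1 h.1.1.2.2.1,
        h.1.1.2.2.2⟩
    · rintro ⟨u, d⟩ - ⟨u', d'⟩ - h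
      simp only [Prod.mk.injEq] at h
      obtain ⟨rfl, rfl⟩ := h
      rfl
  · refine Finset.card_le_card_of_injOn (fun a => ⟨insert a.2 a.1, a.2⟩) ?_ ?_
    · rintro ⟨u, d⟩ h
      simp only [hP, level, Finset.coe_filter, Finset.mem_sigma, Finset.mem_filter,
        Finset.mem_univ, true_and, Finset.mem_sdiff, Set.mem_ofPred_eq, not_not] at h
      simp only [hQ, level, Finset.coe_sigma, Set.mem_sigma_iff, Finset.coe_filter,
        Finset.mem_univ, true_and, Set.mem_ofPred_eq, Finset.coe_sdiff, Set.mem_sdiff,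
        Finset.mem_coe]
      have hdx : d ∉ x := fun hd => h.1.2.2 (h.1.1.2.1 hd)
      refine ⟨⟨h.2, h.1.1.2.1.trans (Finset.subset_insert _ _),
        Finset.insert_subset h.1.2.1 h.1.1.2.2.1, ?_⟩, Finset.mem_insert_self _ _, hdx⟩
      rw [Finset.insert_sdiff_of_notMem _ hdx, Finset.card_insert_of_notMem, h.1.1.2.2.2]
      exact fun hd => h.1.2.2 (Finset.mem_sdiff.1 hd).1
    · rintro ⟨u, d⟩ h ⟨u', d'⟩ h' e
      simp only [hP, Finset.coe_filter, Finset.mem_sigma, Finset.mem_sdiff,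
        Set.mem_ofPred_eq] at h h'
      simp only [Sigma.mk.injEq, heq_eq_eq] at e
      obtain ⟨e, rfl⟩ := e
      have : u = u' := by
        rw [← Finset.erase_insert h.1.2.2, e, Finset.erase_insert h'.1.2.2]
      rw [this]

/-- If `x` is informed at time `a` but `y`, at distance `N` above it, is not at time `a + N`, then
the leaks in the interval from `x` to `y` meet a path from `x` to `y` chosen uniformly at random
at least once on average. -/
theorem one_le_flow {S : ℕ → Set (Finset α)} {x y : Finset α} (hxy : x ⊆ y) {N a : ℕ}
    (hN : (y \ x).card = N) (hx : x ∈ S a) (hy : y ∉ S (a + N)) :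
    (1 : ℚ) ≤ ∑ j ∈ Finset.range N, (((blocked S (a + j)).filter fun p =>
      x ⊆ p.1 ∧ insert p.2 p.1 ⊆ y ∧ (p.1 \ x).card = j).card : ℚ) / (N * (N - 1).choose j) := by
  classical
  -- the density of the informed vertices at height `j`
  set δ : ℕ → ℚ := fun j => ((level x y S (a + j) j).card : ℚ) / N.choose j with hδ
  have h0 : δ 0 = 1 := by
    have : level x y S (a + 0) 0 = {x} := by
      ext u
      simp only [level, Finset.mem_filter, Finset.mem_univ, true_and, Finset.mem_singleton,
        Finset.card_eq_zero, Finset.sdiff_eq_empty_iff_subset]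
      constructor
      · rintro ⟨-, h1, -, h2⟩
        exact h2.antisymm h1
      · rintro rfl
        exact ⟨hx, subset_rfl, hxy, subset_rfl⟩
    simp only [hδ, this]; simp
  have h1 : δ N = 0 := by
    have : level x y S (a + N) N = ∅ := by
      ext u
      simp only [level, Finset.mem_filter, Finset.mem_univ, true_and, Finset.notMem_empty,
        iff_false]
      rintro ⟨h1, h2, h3, h4⟩
      rw [Finset.card_sdiff_of_subset h2] at h4
      rw [Finset.card_sdiff_of_subset hxy] at hN
      have := Finset.card_le_card h2
      have := Finset.card_le_card hxy
      have : u = y := Finset.eq_of_subset_of_card_le h3 (by omega)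
      exact hy (this ▸ h1)
    simp only [hδ, this]; simp
  have h2 : (1 : ℚ) = ∑ j ∈ Finset.range N, (δ j - δ (j + 1)) := by
    rw [Finset.sum_range_sub', h0, h1, sub_zero]
  rw [h2]
  refine Finset.sum_le_sum fun j hj => ?_
  rw [Finset.mem_range] at hj
  have key := card_level_mul_le hxy hN S (a + j) j
  obtain ⟨M, rfl⟩ : ∃ M, N = M + 1 := ⟨N - 1, by omega⟩
  have e1 : ((M + 1 : ℕ) : ℚ) * M.choose j = (M + 1).choose (j + 1) * (j + 1) := by
    exact_mod_cast Nat.add_one_mul_choose_eq M j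
  have e2 : ((M + 1 : ℕ) : ℚ) * M.choose j = (M + 1).choose j * ((M + 1 - j : ℕ) : ℚ) := by
    have := Nat.choose_mul_succ_eq M j
    rw [mul_comm]
    exact_mod_cast this
  have key' : ((level x y S (a + j) j).card : ℚ) * ((M + 1 - j : ℕ) : ℚ) ≤
      (((blocked S (a + j)).filter fun p =>
        x ⊆ p.1 ∧ insert p.2 p.1 ⊆ y ∧ (p.1 \ x).card = j).card : ℚ) +
      ((level x y S (a + (j + 1)) (j + 1)).card : ℚ) * (j + 1) := by
    exact_mod_cast key
  have p1 : (0 : ℚ) < ((M + 1 : ℕ) : ℚ) * M.choose j := by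
    have := Nat.choose_pos (show j ≤ M by omega)
    positivity
  have p2 : (0 : ℚ) < (M + 1).choose j := by
    exact_mod_cast Nat.choose_pos (show j ≤ M + 1 by omega)
  have p3 : (0 : ℚ) < (M + 1).choose (j + 1) := by
    exact_mod_cast Nat.choose_pos (show j + 1 ≤ M + 1 by omega)
  have d1 : δ j = ((level x y S (a + j) j).card : ℚ) * ((M + 1 - j : ℕ) : ℚ) /
      (((M + 1 : ℕ) : ℚ) * M.choose j) := by
    rw [e2, hδ]
    have : (0 : ℚ) < ((M + 1 - j : ℕ) : ℚ) := by exact_mod_cast (by omega)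
    field_simp
  have d2 : δ (j + 1) = ((level x y S (a + (j + 1)) (j + 1)).card : ℚ) * (j + 1) /
      (((M + 1 : ℕ) : ℚ) * M.choose j) := by
    rw [e1, hδ]
    have : (0 : ℚ) < (j : ℚ) + 1 := by positivity
    field_simp
  rw [Nat.add_sub_cancel, d1, d2, ← sub_div]
  exact div_le_div_of_nonneg_right (by linarith) p1.le

/-- The number of the intervals in `D` of which the arc `p` is an arc at height `j`. -/
def load (D : Finset (Finset α × Finset α)) (j : ℕ) (p : Finset α × α) : ℕ :=
  (D.filter fun δ => δ.1 ⊆ p.1 ∧ insert p.2 p.1 ⊆ δ.2 ∧ (p.1 \ δ.1).card = j).card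

/-- The flow inequality, summed over a set `D` of intervals. -/
theorem card_le_sum_load {S : ℕ → Set (Finset α)} {D : Finset (Finset α × Finset α)} {N a : ℕ}
    (hD : ∀ δ ∈ D, δ.1 ⊆ δ.2 ∧ (δ.2 \ δ.1).card = N ∧ δ.1 ∈ S a ∧ δ.2 ∉ S (a + N)) :
    (D.card : ℚ) ≤ ∑ j ∈ Finset.range N, ∑ p ∈ blocked S (a + j),
      (load D j p : ℚ) / (N * (N - 1).choose j) := by
  have h := Finset.sum_le_sum fun δ hδ =>
    one_le_flow (hD δ hδ).1 (hD δ hδ).2.1 (hD δ hδ).2.2.1 (hD δ hδ).2.2.2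
  rw [Finset.sum_const, nsmul_eq_mul, mul_one, Finset.sum_comm] at h
  refine h.trans (le_of_eq (Finset.sum_congr rfl fun j _ => ?_))
  rw [← Finset.sum_div, ← Finset.sum_div]
  congr 1
  simp only [load, Finset.card_filter, Nat.cast_sum]
  rw [Finset.sum_comm]

theorem card_le_of_load_le {f : ℕ} {S : ℕ → Set (Finset α)} (hS : IsContainment (cube α) f S)
    {D : Finset (Finset α × Finset α)} {N a : ℕ}
    (hD : ∀ δ ∈ D, δ.1 ⊆ δ.2 ∧ (δ.2 \ δ.1).card = N ∧ δ.1 ∈ S a ∧ δ.2 ∉ S (a + N)) {ℓ : ℕ → ℕ}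
    (hℓ : ∀ j < N, ∀ p : Finset α × α, p.2 ∉ p.1 → load D j p ≤ ℓ j) :
    (D.card : ℚ) ≤ ∑ j ∈ Finset.range N, (f * ℓ j : ℚ) / (N * (N - 1).choose j) := by
  refine (card_le_sum_load hD).trans (Finset.sum_le_sum fun j hj => ?_)
  rw [Finset.mem_range] at hj
  rw [← Finset.sum_div]
  refine div_le_div_of_nonneg_right ?_ (by positivity)
  have h1 : ∑ p ∈ blocked S (a + j), load D j p ≤ (blocked S (a + j)).card * ℓ j :=
    Finset.sum_le_card_nsmul _ _ _ fun p hp => hℓ j hj p (mem_blocked.1 hp).1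
  exact_mod_cast h1.trans (Nat.mul_le_mul_right _ (card_blocked_le hS _))

end Flow

/-! ### Flows between a star of the source and a star of the antipode -/

section Star

variable {α : Type} [DecidableEq α] [Fintype α]

/-- The intervals from `insert c p` to the complement of `insert c' q`, for distinct `c, c' ∈ K`. -/
def starPairs (p q K : Finset α) : Finset (Finset α × Finset α) :=
  K.offDiag.image fun c => (insert c.1 p, (insert c.2 q)ᶜ)

theorem mem_starPairs {p q K : Finset α} {δ : Finset α × Finset α} :
    δ ∈ starPairs p q K ↔
      ∃ c c', c ∈ K ∧ c' ∈ K ∧ c ≠ c' ∧ δ = (insert c p, (insert c' q)ᶜ) := by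
  simp only [starPairs, Finset.mem_image, Finset.mem_offDiag, Prod.exists, and_assoc]
  constructor
  · rintro ⟨c, c', h1, h2, h3, rfl⟩; exact ⟨c, c', h1, h2, h3, rfl⟩
  · rintro ⟨c, c', h1, h2, h3, rfl⟩; exact ⟨c, c', h1, h2, h3, rfl⟩

theorem card_starPairs {p q K : Finset α} (hK : Disjoint K (p ∪ q)) :
    (starPairs p q K).card = K.card * K.card - K.card := by
  rw [starPairs, Finset.card_image_of_injOn, Finset.offDiag_card]
  rintro ⟨c, c'⟩ h ⟨e, e'⟩ h' heq
  simp only [Finset.coe_offDiag, Set.mem_offDiag, Finset.mem_coe] at h h'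
  simp only [Prod.mk.injEq, compl_inj_iff] at heq
  have hK' : ∀ c ∈ K, c ∉ p ∧ c ∉ q := by
    intro c hc
    have := Finset.disjoint_left.1 hK hc
    simpa using this
  have h1 : c ∈ insert e p := heq.1 ▸ Finset.mem_insert_self c p
  have h2 : c' ∈ insert e' q := heq.2 ▸ Finset.mem_insert_self c' q
  rw [(Finset.mem_insert.1 h1).resolve_right (hK' c h.1).1,
    (Finset.mem_insert.1 h2).resolve_right (hK' c' h.2.1).2]

/-- A bound for the number of pairs of elements of a `k`-set that an arc at height `j` of an
`N`-dimensional interval can separate. -/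
def starLoad (N k j : ℕ) : ℕ := if j = 0 ∨ j + 1 = N then k - 1 else k * k / 4

theorem mul_le_starLoad {N k j a b : ℕ} (ha : a ≤ j + 1) (hb : b ≤ N - j) (hab : a + b ≤ k) :
    a * b ≤ starLoad N k j := by
  unfold starLoad
  split_ifs with h
  · rcases h with h | h
    · have : a ≤ 1 := by omega
      interval_cases a
      · simp
      · omega
    · have : b ≤ 1 := by omega
      interval_cases b
      · simp
      · omega
  · rw [Nat.le_div_iff_mul_le (by norm_num)]
    have h1 : (a + b) * (a + b) ≤ k * k := Nat.mul_le_mul hab hab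
    zify at h1 ⊢
    nlinarith [sq_nonneg ((a : ℤ) - b)]

/-- An arc at height `j` of an interval from `insert c p` upwards has at most `j + 1` elements of
`K` in its lower end, and its upper end misses at most `N - j`: only these can be `c` and `c'`. -/
theorem load_starPairs {p q K : Finset α} (hpq : Disjoint p q) (hK : Disjoint K (p ∪ q)) {N j : ℕ}
    (hN : ((p ∪ q)ᶜ).card = N + 2) (a : Finset α × α) (ha : a.2 ∉ a.1) :
    load (starPairs p q K) j a = 0 ∨ (p ⊆ a.1 ∧ Disjoint q a.1 ∧
      load (starPairs p q K) j a ≤ starLoad N K.card j) := by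
  obtain ⟨u, d⟩ := a
  rw [or_iff_not_imp_left]
  intro h0
  obtain ⟨δ, hδ⟩ := Finset.card_pos.1 (Nat.pos_of_ne_zero h0)
  rw [Finset.mem_filter, mem_starPairs] at hδ
  obtain ⟨⟨c, c', hc, hc', hcc, rfl⟩, h1, h2, h3⟩ := hδ
  simp only at ha h1 h2 h3
  have hK' : ∀ c ∈ K, c ∉ p ∧ c ∉ q := by
    intro c hc
    have := Finset.disjoint_left.1 hK hc
    simpa using this
  have hp : p ⊆ u := (Finset.subset_insert c p).trans h1
  have hq : Disjoint q (insert d u) := by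
    rw [Finset.disjoint_left]
    intro x hx hx'
    have := h2 hx'
    simp [hx] at this
  refine ⟨hp, hq.mono_right (Finset.subset_insert _ _), ?_⟩
  have hle : load (starPairs p q K) j (u, d) ≤ (K ∩ u).card * (K \ insert d u).card := by
    rw [← Finset.card_product]
    refine (Finset.card_le_card ?_).trans (Finset.card_image_le
      (s := (K ∩ u) ×ˢ (K \ insert d u)) (f := fun c => (insert c.1 p, (insert c.2 q)ᶜ)))
    intro δ hδ
    rw [Finset.mem_filter, mem_starPairs] at hδ
    obtain ⟨⟨e, e', he, he', -, rfl⟩, g1, g2, -⟩ := hδ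
    rw [Finset.mem_image]
    refine ⟨(e, e'), ?_, rfl⟩
    simp only [Finset.mem_product, Finset.mem_inter, Finset.mem_sdiff]
    refine ⟨⟨he, g1 (Finset.mem_insert_self _ _)⟩, he', fun h => ?_⟩
    have := g2 h
    simp at this
  refine hle.trans (mul_le_starLoad ?_ ?_ ?_)
  · have e1 : u.card = (insert c p).card + j := by
      rw [Finset.card_sdiff_of_subset h1] at h3
      have := Finset.card_le_card h1
      omega
    rw [Finset.card_insert_of_notMem (hK' c hc).1] at e1
    have e2 : (K ∩ u).card ≤ (u \ p).card := by
      refine Finset.card_le_card fun x hx => ?_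
      rw [Finset.mem_inter] at hx
      exact Finset.mem_sdiff.2 ⟨hx.2, (hK' x hx.1).1⟩
    rw [Finset.card_sdiff_of_subset hp] at e2
    omega
  · have e1 : u.card = (insert c p).card + j := by
      rw [Finset.card_sdiff_of_subset h1] at h3
      have := Finset.card_le_card h1
      omega
    rw [Finset.card_insert_of_notMem (hK' c hc).1] at e1
    have e2 : (K \ insert d u).card ≤ ((q ∪ insert d u)ᶜ).card := by
      refine Finset.card_le_card fun x hx => ?_
      rw [Finset.mem_sdiff] at hx
      rw [Finset.mem_compl, Finset.mem_union]
      exact fun h => h.elim (hK' x hx.1).2 hx.2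
    rw [Finset.card_compl, Finset.card_union_of_disjoint hq, Finset.card_insert_of_notMem ha] at e2
    rw [Finset.card_compl, Finset.card_union_of_disjoint hpq] at hN
    omega
  · rw [← Finset.card_union_of_disjoint]
    · refine Finset.card_le_card fun x hx => ?_
      simp only [Finset.mem_union, Finset.mem_inter, Finset.mem_sdiff] at hx
      tauto
    · rw [Finset.disjoint_left]
      intro x hx hx'
      simp only [Finset.mem_inter, Finset.mem_sdiff, Finset.mem_insert] at hx hx'
      tauto

theorem starPairs_prop {p q K : Finset α} (hpq : Disjoint p q) (hK : Disjoint K (p ∪ q)) {N : ℕ}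
    (hN : ((p ∪ q)ᶜ).card = N + 2) {S : ℕ → Set (Finset α)} {a : ℕ}
    (hx : ∀ c ∈ K, insert c p ∈ S a) (hy : ∀ c ∈ K, (insert c q)ᶜ ∉ S (a + N)) :
    ∀ δ ∈ starPairs p q K,
      δ.1 ⊆ δ.2 ∧ (δ.2 \ δ.1).card = N ∧ δ.1 ∈ S a ∧ δ.2 ∉ S (a + N) := by
  intro δ hδ
  obtain ⟨c, c', hc, hc', hcc, rfl⟩ := mem_starPairs.1 hδ
  have hK' : ∀ c ∈ K, c ∉ p ∧ c ∉ q := by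
    intro c hc
    have := Finset.disjoint_left.1 hK hc
    simpa using this
  have hdis : Disjoint (insert c p) (insert c' q) := by
    rw [Finset.disjoint_insert_left, Finset.disjoint_insert_right, Finset.mem_insert]
    have := hK' c hc
    have := hK' c' hc'
    tauto
  have hsub : insert c p ⊆ (insert c' q)ᶜ := by
    intro x hx
    rw [Finset.mem_compl]
    exact Finset.disjoint_left.1 hdis hx
  refine ⟨hsub, ?_, hx c hc, hy c' hc'⟩
  simp only
  rw [Finset.card_sdiff_of_subset hsub, Finset.card_compl,
    Finset.card_insert_of_notMem (hK' c hc).1, Finset.card_insert_of_notMem (hK' c' hc').2]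
  rw [Finset.card_compl, Finset.card_union_of_disjoint hpq] at hN
  omega

/-- The flow inequality for one family of intervals between stars. -/
theorem star_flow {f : ℕ} {S : ℕ → Set (Finset α)} (hS : IsContainment (cube α) f S)
    {p q K : Finset α} (hpq : Disjoint p q) (hK : Disjoint K (p ∪ q)) {N : ℕ}
    (hN : ((p ∪ q)ᶜ).card = N + 2) {a : ℕ}
    (hx : ∀ c ∈ K, insert c p ∈ S a) (hy : ∀ c ∈ K, (insert c q)ᶜ ∉ S (a + N)) :
    ((K.card * K.card - K.card : ℕ) : ℚ) ≤
      ∑ j ∈ Finset.range N, (f * starLoad N K.card j : ℚ) / (N * (N - 1).choose j) := by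
  rw [← card_starPairs hK]
  refine card_le_of_load_le hS (starPairs_prop hpq hK hN hx hy) fun j _ a ha => ?_
  rcases load_starPairs (j := j) hpq hK hN a ha with h | h
  · omega
  · exact h.2.2

/-- The flow inequality for two families of intervals between stars that lie in disjoint subcubes,
so that no arc carries flow of both. -/
theorem star_flow_two {f : ℕ} {S : ℕ → Set (Finset α)} (hS : IsContainment (cube α) f S)
    {p q K : Finset α} (hpq : Disjoint p q) (hne : (p ∪ q).Nonempty) (hK : Disjoint K (p ∪ q))
    {N : ℕ} (hN : ((p ∪ q)ᶜ).card = N + 2) {a : ℕ}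
    (hx : ∀ c ∈ K, insert c p ∈ S a) (hy : ∀ c ∈ K, (insert c q)ᶜ ∉ S (a + N))
    (hx' : ∀ c ∈ K, insert c q ∈ S a) (hy' : ∀ c ∈ K, (insert c p)ᶜ ∉ S (a + N)) :
    ((2 * (K.card * K.card - K.card) : ℕ) : ℚ) ≤
      ∑ j ∈ Finset.range N, (f * starLoad N K.card j : ℚ) / (N * (N - 1).choose j) := by
  have hqp := hpq.symm
  have hK2 : Disjoint K (q ∪ p) := by rwa [Finset.union_comm]
  have hN2 : ((q ∪ p)ᶜ).card = N + 2 := by rwa [Finset.union_comm]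
  have hdis : Disjoint (starPairs p q K) (starPairs q p K) := by
    rw [Finset.disjoint_left]
    intro δ h h'
    obtain ⟨c, c', hc, hc', -, rfl⟩ := mem_starPairs.1 h
    obtain ⟨e, e', he, he', -, heq⟩ := mem_starPairs.1 h'
    simp only [Prod.mk.injEq] at heq
    obtain ⟨x, hx⟩ := hne
    have h1 := Finset.disjoint_right.1 hK hx
    have h2 : x ∈ insert c p ↔ x ∈ insert e q := by rw [heq.1]
    have h3 : ∀ e ∈ K, x ≠ e := fun e he h => h1 (h ▸ he)
    have h4 : x ∈ p → x ∉ q := fun h => Finset.disjoint_left.1 hpq h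
    rw [Finset.mem_insert, Finset.mem_insert] at h2
    rw [Finset.mem_union] at hx
    have := h3 c hc
    have := h3 e he
    tauto
  have hcard : (starPairs p q K ∪ starPairs q p K).card = 2 * (K.card * K.card - K.card) := by
    rw [Finset.card_union_of_disjoint hdis, card_starPairs hK, card_starPairs hK2]
    ring
  rw [← hcard]
  refine card_le_of_load_le (a := a) hS ?_ fun j _ a ha => ?_
  · intro δ hδ
    rcases Finset.mem_union.1 hδ with h | h
    · exact starPairs_prop hpq hK hN hx hy δ h
    · exact starPairs_prop hqp hK2 hN2 hx' hy' δ h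
  · have hle : load (starPairs p q K ∪ starPairs q p K) j a
        ≤ load (starPairs p q K) j a + load (starPairs q p K) j a := by
      unfold load
      rw [Finset.filter_union]
      exact Finset.card_union_le _ _
    refine hle.trans ?_
    rcases load_starPairs (j := j) hpq hK hN a ha with h | h <;>
      rcases load_starPairs (j := j) hqp hK2 hN2 a ha with h' | h'
    · omega
    · have := h'.2.2; omega
    · have := h.2.2; omega
    · exfalso
      obtain ⟨x, hx⟩ := hne
      rcases Finset.mem_union.1 hx with hx | hx
      · exact Finset.disjoint_left.1 h'.2.1 hx (h.1 hx)
      · exact Finset.disjoint_left.1 h.2.1 hx (h'.1 hx)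

end Star

/-! ### Numerical estimates -/

theorem le_choose_of_interior {m i : ℕ} (h1 : 1 ≤ i) (h2 : i < m) : m ≤ m.choose i := by
  induction m generalizing i with
  | zero => omega
  | succ m ih =>
    obtain ⟨i, rfl⟩ : ∃ i', i = i' + 1 := ⟨i - 1, by omega⟩
    rw [Nat.choose_succ_succ']
    have h3 := Nat.choose_pos (show i ≤ m by omega)
    by_cases h : i + 1 < m
    · have := ih h1 h
      omega
    · have : i + 1 = m := by omega
      subst this
      simp

/-- The heights at the two ends of the intervals carry most of the flow. -/
theorem sum_starLoad_le {f M k : ℕ} (hf : f ≤ M + 3) (hk : 1 ≤ k) :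
    ∑ j ∈ Finset.range (M + 2), (f * starLoad (M + 2) k j : ℚ) /
        (((M + 2 : ℕ) : ℚ) * (M + 2 - 1).choose j) ≤
      (M + 3) * (2 * (k - 1) / (M + 2) + M * k ^ 2 / (4 * ((M + 2) * (M + 1)))) := by
  have hf' : (f : ℚ) ≤ M + 3 := by exact_mod_cast hf
  have hk' : (1 : ℚ) ≤ k := by exact_mod_cast hk
  have hM : (0 : ℚ) ≤ M := by positivity
  have e1 : (starLoad (M + 2) k 0 : ℚ) = k - 1 := by
    simp [starLoad, Nat.cast_sub hk]
  have e2 : (starLoad (M + 2) k (M + 1) : ℚ) = k - 1 := by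
    simp [starLoad, Nat.cast_sub hk]
  rw [Finset.sum_range_succ, Finset.sum_range_succ']
  have hint : ∑ j ∈ Finset.range M, (f * starLoad (M + 2) k (j + 1) : ℚ) /
        (((M + 2 : ℕ) : ℚ) * (M + 2 - 1).choose (j + 1)) ≤
      M * ((M + 3) * (k ^ 2 / 4) / ((M + 2) * (M + 1))) := by
    have : ∀ j ∈ Finset.range M, (f * starLoad (M + 2) k (j + 1) : ℚ) /
        (((M + 2 : ℕ) : ℚ) * (M + 2 - 1).choose (j + 1)) ≤
        (M + 3) * (k ^ 2 / 4) / ((M + 2) * (M + 1)) := by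
      intro j hj
      rw [Finset.mem_range] at hj
      have h1 : ((M + 1 : ℕ) : ℚ) ≤ (M + 2 - 1).choose (j + 1) := by
        exact_mod_cast le_choose_of_interior (by omega) (by omega)
      have h2 : (starLoad (M + 2) k (j + 1) : ℚ) ≤ k ^ 2 / 4 := by
        have : starLoad (M + 2) k (j + 1) = k * k / 4 := by
          unfold starLoad
          rw [if_neg (by omega)]
        rw [this, sq]
        have := @Nat.cast_div_le ℚ _ _ _ (k * k) 4
        push_cast at this
        exact this
      push_cast at h1 ⊢
      gcongr
    have := Finset.sum_le_card_nsmul _ _ _ this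
    rwa [Finset.card_range, nsmul_eq_mul] at this
  have h0 : (f * starLoad (M + 2) k 0 : ℚ) / (((M + 2 : ℕ) : ℚ) * (M + 2 - 1).choose 0)
      ≤ (M + 3) * (k - 1) / (M + 2) := by
    rw [e1, Nat.choose_zero_right]
    push_cast
    rw [mul_one]
    gcongr
  have h1 : (f * starLoad (M + 2) k (M + 1) : ℚ) /
      (((M + 2 : ℕ) : ℚ) * (M + 2 - 1).choose (M + 1)) ≤ (M + 3) * (k - 1) / (M + 2) := by
    rw [e2, show M + 2 - 1 = M + 1 by omega, Nat.choose_self]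
    push_cast
    rw [mul_one]
    gcongr
  refine (add_le_add (add_le_add hint h0) h1).trans (le_of_eq ?_)
  field_simp
  ring

/-- One family of intervals, in a cube of dimension `N + 2 ≥ 6`, cannot be cut by `N + 1` failures
per round. -/
theorem sum_starLoad_lt_one {f N : ℕ} (hN : 4 ≤ N) (hf : f ≤ N + 1) :
    ∑ j ∈ Finset.range N, (f * starLoad N (N / 2 + 2) j : ℚ) / (N * (N - 1).choose j) <
      (((N / 2 + 2) * (N / 2 + 2) - (N / 2 + 2) : ℕ) : ℚ) := by
  obtain ⟨M, rfl⟩ : ∃ M, N = M + 2 := ⟨N - 2, by omega⟩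
  refine (sum_starLoad_le (by omega) (by omega)).trans_lt ?_
  set s := (M + 2) / 2 with hs
  have e : (((s + 2) * (s + 2) - (s + 2) : ℕ) : ℚ) = (s + 2) * (s + 1) := by
    rw [show (s + 2) * (s + 2) - (s + 2) = (s + 2) * (s + 1) by
      rw [Nat.sub_eq_iff_eq_add (Nat.le_mul_self _)]; ring]
    push_cast; ring
  rw [e]
  obtain ⟨t, ht⟩ : ∃ t, s = t + 2 := ⟨s - 2, by omega⟩
  rcases (show M = 2 * t + 2 ∨ M = 2 * t + 3 by omega) with h | h
  · rw [ht, h]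
    push_cast
    rw [div_add_div _ _ (by positivity) (by positivity), ← mul_div_assoc,
      div_lt_iff₀ (by positivity)]
    have : (0 : ℚ) ≤ t := by positivity
    rw [← sub_pos]
    ring_nf
    positivity
  · rw [ht, h]
    push_cast
    rw [div_add_div _ _ (by positivity) (by positivity), ← mul_div_assoc,
      div_lt_iff₀ (by positivity)]
    have : (0 : ℚ) ≤ t := by positivity
    rw [← sub_pos]
    ring_nf
    positivity

/-- Two families of intervals, in disjoint subcubes of dimension `N + 2`, cannot be cut by `N + 1`
failures per round. -/
theorem sum_starLoad_lt_two {f N : ℕ} (hf : f ≤ N + 1) :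
    ∑ j ∈ Finset.range N, (f * starLoad N (N / 2 + 2) j : ℚ) / (N * (N - 1).choose j) <
      ((2 * ((N / 2 + 2) * (N / 2 + 2) - (N / 2 + 2)) : ℕ) : ℚ) := by
  rcases (show N = 0 ∨ N = 1 ∨ 2 ≤ N by omega) with rfl | rfl | hN
  · norm_num
  · have : (f : ℚ) ≤ 2 := by exact_mod_cast hf
    norm_num [starLoad]
    linarith
  obtain ⟨M, rfl⟩ : ∃ M, N = M + 2 := ⟨N - 2, by omega⟩
  refine (sum_starLoad_le (by omega) (by omega)).trans_lt ?_
  set s := (M + 2) / 2 with hs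
  have e : ((2 * ((s + 2) * (s + 2) - (s + 2)) : ℕ) : ℚ) = 2 * ((s + 2) * (s + 1)) := by
    rw [show (s + 2) * (s + 2) - (s + 2) = (s + 2) * (s + 1) by
      rw [Nat.sub_eq_iff_eq_add (Nat.le_mul_self _)]; ring]
    push_cast; ring
  rw [e]
  obtain ⟨t, ht⟩ : ∃ t, s = t + 1 := ⟨s - 1, by omega⟩
  rcases (show M = 2 * t ∨ M = 2 * t + 1 by omega) with h | h
  · rw [ht, h]
    push_cast
    rw [div_add_div _ _ (by positivity) (by positivity), ← mul_div_assoc,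
      div_lt_iff₀ (by positivity)]
    have : (0 : ℚ) ≤ t := by positivity
    rw [← sub_pos]
    ring_nf
    positivity
  · rw [ht, h]
    push_cast
    rw [div_add_div _ _ (by positivity) (by positivity), ← mul_div_assoc,
      div_lt_iff₀ (by positivity)]
    have : (0 : ℚ) ≤ t := by positivity
    rw [← sub_pos]
    ring_nf
    positivity

/-! ### The first two rounds of a compressed containment -/

open Classical in
/-- The elements `c` such that the arc from `u` to `insert c u` leaks in round `r`. -/
noncomputable def blockedAt {n : ℕ} (S : ℕ → Set (Finset (Fin n))) (r : ℕ) (u : Finset (Fin n)) :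
    Finset (Fin n) :=
  Finset.univ.filter fun c => c ∉ u ∧ insert c u ∉ S (r + 1)

theorem mem_blockedAt {n : ℕ} {S : ℕ → Set (Finset (Fin n))} {r : ℕ} {u : Finset (Fin n)}
    {c : Fin n} : c ∈ blockedAt S r u ↔ c ∉ u ∧ insert c u ∉ S (r + 1) := by
  simp [blockedAt]

theorem card_blockedAt_add_le {n f : ℕ} {S : ℕ → Set (Finset (Fin n))}
    (hS : IsContainment (cube (Fin n)) f S) {r : ℕ} {u v : Finset (Fin n)} (hu : u ∈ S r)
    (hv : v ∈ S r) (huv : u ≠ v) : (blockedAt S r u).card + (blockedAt S r v).card ≤ f := by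
  refine le_trans ?_ (card_blocked_le hS r)
  rw [← Finset.card_map ⟨fun c => (u, c), Prod.mk_right_injective u⟩,
    ← Finset.card_map (s := blockedAt S r v) ⟨fun c => (v, c), Prod.mk_right_injective v⟩,
    ← Finset.card_union_of_disjoint]
  · refine Finset.card_le_card fun p hp => ?_
    simp only [Finset.mem_union, Finset.mem_map, Function.Embedding.coeFn_mk, mem_blockedAt] at hp
    rw [mem_blocked]
    rcases hp with ⟨c, ⟨h1, h2⟩, rfl⟩ | ⟨c, ⟨h1, h2⟩, rfl⟩
    · exact ⟨h1, hu, h2⟩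
    · exact ⟨h1, hv, h2⟩
  · rw [Finset.disjoint_left]
    intro p hp hp'
    simp only [Finset.mem_map, Function.Embedding.coeFn_mk] at hp hp'
    obtain ⟨c, -, rfl⟩ := hp
    obtain ⟨c', -, h⟩ := hp'
    exact huv (congrArg Prod.fst h).symm

theorem card_blockedAt_le {n f : ℕ} {S : ℕ → Set (Finset (Fin n))}
    (hS : IsContainment (cube (Fin n)) f S) {r : ℕ} {u : Finset (Fin n)} (hu : u ∈ S r) :
    (blockedAt S r u).card ≤ f := by
  refine le_trans ?_ (card_blocked_le hS r)
  rw [← Finset.card_map ⟨fun c => (u, c), Prod.mk_right_injective u⟩]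
  refine Finset.card_le_card fun p hp => ?_
  simp only [Finset.mem_map, Function.Embedding.coeFn_mk, mem_blockedAt] at hp
  rw [mem_blocked]
  obtain ⟨c, ⟨h1, h2⟩, rfl⟩ := hp
  exact ⟨h1, hu, h2⟩

theorem sum_blocked_le {n f b : ℕ} {S : ℕ → Set (Finset (Fin n))}
    (hS : IsContainment (cube (Fin n)) f S) (r : ℕ) {g : Finset (Fin n) × Fin n → ℕ}
    (hg : ∀ p : Finset (Fin n) × Fin n, p.2 ∉ p.1 → g p ≤ b) :
    ∑ p ∈ blocked S r, g p ≤ f * b :=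
  (Finset.sum_le_card_nsmul _ _ _ fun p hp => hg p (mem_blocked.1 hp).1).trans
    (Nat.mul_le_mul_right _ (card_blocked_le hS r))

section Compressed

variable {n f T : ℕ} {S : ℕ → Set (Finset (Fin n))}

/-- By shifting, the elements above `u` whose arcs from `u` leak form a final segment. -/
theorem IsCompressed.insert_mem (hS : IsCompressed f T S) {r : ℕ} (hr : r < T)
    {u : Finset (Fin n)} {c : Fin n} (hc : ∀ a ∈ u, a < c)
    (hlt : (c : ℕ) + (blockedAt S r u).card < n) : insert c u ∈ S (r + 1) := by
  by_contra h
  have hsub : Finset.Ici c ⊆ blockedAt S r u := by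
    intro d hd
    rw [Finset.mem_Ici] at hd
    have hdu : d ∉ u := fun h => absurd (hc d h) (not_lt.2 hd)
    refine mem_blockedAt.2 ⟨hdu, fun h' => h ?_⟩
    rcases hd.eq_or_lt with rfl | hd
    · exact h'
    · have hcu : c ∉ u := fun h => absurd (hc c h) (lt_irrefl _)
      have := hS.shift _ (by omega) _ h' c d hd (Finset.mem_insert_self _ _)
        (by simp [hd.ne, hcu])
      rwa [Finset.erase_insert hdu] at this
  have := Finset.card_le_card hsub
  rw [Fin.card_Ici] at this
  omega

theorem IsCompressed.singleton_mem_one (hS : IsCompressed f T S) (hT : 1 ≤ T) {c : Fin n}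
    (hc : (c : ℕ) + f < n) : {c} ∈ S 1 := by
  have := card_blockedAt_le hS.cont hS.empty_mem
  exact hS.insert_mem (r := 0) (by omega) (u := ∅) (by simp) (by omega)

/-- Down-closure balances the leaks from the source against those from its first neighbour. -/
theorem IsCompressed.card_blockedAt_empty_le (hS : IsCompressed f T S) (hT : 2 ≤ T) {a : Fin n}
    (ha : {a} ∈ S 1) : (blockedAt S 1 ∅).card ≤ (blockedAt S 1 {a}).card := by
  refine Finset.card_le_card fun c hc => ?_
  rw [mem_blockedAt] at hc ⊢
  refine ⟨fun h => hc.2 ?_, fun h => hc.2 (hS.down 2 hT _ h _ (by simp))⟩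
  rw [Finset.mem_singleton] at h
  subst h
  exact hS.cont.mono 1 (by simpa using ha)

/-- Shifting balances the leaks from two neighbours of the source. -/
theorem IsCompressed.card_blockedAt_singleton_le (hS : IsCompressed f T S) (hT : 2 ≤ T)
    {a b : Fin n} (hab : a < b) : (blockedAt S 1 {a}).card ≤ (blockedAt S 1 {b}).card := by
  refine Finset.card_le_card_of_injOn (Equiv.swap a b) ?_ (Equiv.injective _).injOn
  intro c hc
  rw [Finset.mem_coe, mem_blockedAt, Finset.mem_singleton] at hc ⊢
  obtain ⟨hca, hc⟩ := hc
  by_cases hcb : c = b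
  · subst hcb
    rw [Equiv.swap_apply_right]
    exact ⟨fun h => hca h.symm, by rwa [Finset.pair_comm]⟩
  · rw [Equiv.swap_apply_of_ne_of_ne hca hcb]
    refine ⟨hcb, fun h => hc ?_⟩
    have := hS.shift 2 hT _ h a b hab (by simp) (by simp [Ne.symm hca, hab.ne])
    rw [Finset.pair_comm, Finset.erase_insert (by simpa using Ne.symm hcb)] at this
    rwa [Finset.pair_comm]

theorem IsCompressed.singleton_mem_two (hS : IsCompressed f T S) (hT : 2 ≤ T) {a c : Fin n}
    (ha : (a : ℕ) + f < n) (hc : (c : ℕ) + f / 2 < n) : {c} ∈ S 2 := by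
  have h1 := hS.singleton_mem_one (by omega) ha
  have h2 := hS.card_blockedAt_empty_le hT h1
  have h3 := card_blockedAt_add_le (r := 1) hS.cont (hS.cont.mono 0 hS.empty_mem) h1
    (Finset.singleton_ne_empty a).symm
  exact hS.insert_mem (r := 1) (by omega) (u := ∅) (by simp) (by omega)

theorem IsCompressed.pair_mem_two (hS : IsCompressed f T S) (hT : 2 ≤ T) {a b c : Fin n}
    (hab : a < b) (hb : (b : ℕ) + f < n) (hac : a < c) (hc : (c : ℕ) + f / 2 < n) :
    {c, a} ∈ S 2 := by
  have h1 := hS.singleton_mem_one (by omega) (c := a) (by have : (a : ℕ) < b := hab; omega)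
  have h2 := hS.singleton_mem_one (by omega) hb
  have h3 := hS.card_blockedAt_singleton_le hT hab
  have h4 := card_blockedAt_add_le hS.cont h1 h2 (by simpa using hab.ne)
  exact hS.insert_mem (r := 1) (by omega) (u := {a}) (by simpa using hac) (by omega)

/-- If few neighbours of the source are informed at time `2`, then many neighbours of its first
neighbour are. -/
theorem IsCompressed.pair_mem_two_of_singleton_notMem (hS : IsCompressed f T S) (hT : 2 ≤ T)
    {a c d : Fin n} (ha : (a : ℕ) + f < n) (hd : {d} ∉ S 2) (hac : a < c)
    (hc : (c : ℕ) + f + d < 2 * n) : {c, a} ∈ S 2 := by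
  have h1 := hS.singleton_mem_one (by omega) ha
  have h3 := card_blockedAt_add_le (r := 1) hS.cont (hS.cont.mono 0 hS.empty_mem) h1
    (Finset.singleton_ne_empty a).symm
  have h4 : n ≤ (d : ℕ) + (blockedAt S 1 ∅).card := by
    by_contra h
    exact hd (hS.insert_mem (r := 1) (by omega) (u := ∅) (by simp) (by omega))
  exact hS.insert_mem (r := 1) (by omega) (u := {a}) (by simpa using hac) (by omega)

theorem compl_notMem_of_mem_dual {x : Finset (Fin n)} {r : ℕ} (h : r ≤ T) (hx : x ∈ dual T S r) :
    xᶜ ∉ S (T - r) := hx h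

end Compressed

/-! ### The message cannot be withheld from the antipode -/

/-- The first `k` elements from `h` on. -/
def segment (n h k : ℕ) : Finset (Fin n) :=
  Finset.univ.filter fun c => h ≤ (c : ℕ) ∧ (c : ℕ) < h + k

theorem card_segment {n h k : ℕ} (hk : h + k ≤ n) : (segment n h k).card = k := by
  have : (segment n h k).map Fin.valEmbedding = Finset.Ico h (h + k) := by
    ext i
    simp only [segment, Finset.mem_map, Finset.mem_filter, Finset.mem_univ, true_and,
      Fin.valEmbedding_apply, Finset.mem_Ico]
    constructor
    · rintro ⟨c, hc, rfl⟩; exact hc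
    · intro hi; exact ⟨⟨i, by omega⟩, hi, rfl⟩
  rw [← Finset.card_map Fin.valEmbedding, this, Nat.card_Ico]
  omega

theorem mem_segment {n h k : ℕ} {c : Fin n} :
    c ∈ segment n h k ↔ h ≤ (c : ℕ) ∧ (c : ℕ) < h + k := by
  simp [segment]

/-- With `n - 3` failures, `n` rounds inform the antipode: the intervals from `insert c {0}` to the
complement of `insert c' {1}`, and those with `0` and `1` exchanged, cannot be cut. -/
theorem not_isCompressed_sub_three {n f : ℕ} (hf : f + 3 = n) {S : ℕ → Set (Finset (Fin n))} :
    ¬ IsCompressed f n S := by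
  intro hS
  rcases (show n = 3 ∨ 4 ≤ n by omega) with h | hn
  · subst h
    obtain rfl : f = 0 := by omega
    have h1 := card_le_of_load_le hS.cont (D := {(∅, Finset.univ)}) (N := 3) (a := 0)
      (ℓ := fun _ => 1) (by
        simp only [Finset.mem_singleton, forall_eq]
        exact ⟨by simp, by simp, hS.empty_mem, hS.univ_notMem⟩)
      (fun j _ p _ => (Finset.card_filter_le _ _).trans (by simp))
    norm_num at h1
  · have hd := hS.dual
    let e0 : Fin n := ⟨0, by omega⟩
    let e1 : Fin n := ⟨1, by omega⟩
    let e2 : Fin n := ⟨2, by omega⟩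
    have h01 : e0 < e1 := by simp [e0, e1]
    have h12 : e1 < e2 := by simp [e1, e2]
    obtain ⟨N, rfl⟩ : ∃ N, n = N + 4 := ⟨n - 4, by omega⟩
    have hK : (segment (N + 4) 2 (N / 2 + 2)).card = N / 2 + 2 := card_segment (by omega)
    have key : ∀ S, IsCompressed f (N + 4) S → ∀ c ∈ segment (N + 4) 2 (N / 2 + 2),
        insert c {e0} ∈ S 2 ∧ insert c {e1} ∈ S 2 := by
      intro S hS c hc
      rw [mem_segment] at hc
      have h0c : e0 < c := by rw [Fin.lt_def]; simp only [e0]; omega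
      have h1c : e1 < c := by rw [Fin.lt_def]; simp only [e1]; omega
      have h2 := hS.pair_mem_two (by omega) h12 (by simp only [e2]; omega) h1c (by omega)
      refine ⟨?_, h2⟩
      have := hS.shift 2 (by omega) _ h2 e0 e1 h01 (by simp) (by simp [h0c.ne, h01.ne])
      rw [Finset.pair_comm, Finset.erase_insert (by simp [h1c.ne])] at this
      rwa [Finset.pair_comm]
    have h1 := star_flow_two (N := N) (a := 2) hS.cont (p := {e0}) (q := {e1})
      (K := segment (N + 4) 2 (N / 2 + 2)) (by simpa using h01.ne) (by simp)
      (by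
        rw [Finset.disjoint_left]
        intro c hc h
        rw [mem_segment] at hc
        simp only [Finset.mem_union, Finset.mem_singleton, e0, e1] at h
        rcases h with rfl | rfl <;> simp at hc)
      (by
        rw [Finset.card_compl, Finset.card_union_of_disjoint (by simpa using h01.ne)]
        simp)
      (fun c hc => (key S hS c hc).1)
      (fun c hc h => compl_notMem_of_mem_dual (r := 2) (by omega) (key _ hd c hc).2
        (by rwa [show N + 4 - 2 = 2 + N by omega]))
      (fun c hc => (key S hS c hc).2)
      (fun c hc h => compl_notMem_of_mem_dual (r := 2) (by omega) (key _ hd c hc).1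
        (by rwa [show N + 4 - 2 = 2 + N by omega]))
    rw [hK] at h1
    exact absurd h1 (not_le.2 (sum_starLoad_lt_two (by omega)))

/-- With `n - 2` failures, `n + 1` rounds inform the antipode: the intervals from `insert c {0}` to
`{c'}ᶜ` and those from `{c}` to the complement of `insert c' {0}` cannot be cut. -/
theorem not_isCompressed_sub_two {n f : ℕ} (hn : 3 ≤ n) (hf : f + 2 = n)
    {S : ℕ → Set (Finset (Fin n))} : ¬ IsCompressed f (n + 1) S := by
  intro hS
  have hd := hS.dual
  let e0 : Fin n := ⟨0, by omega⟩
  let e1 : Fin n := ⟨1, by omega⟩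
  have h01 : e0 < e1 := by simp [e0, e1]
  obtain ⟨N, rfl⟩ : ∃ N, n = N + 3 := ⟨n - 3, by omega⟩
  have hK : (segment (N + 3) 1 (N / 2 + 2)).card = N / 2 + 2 := card_segment (by omega)
  have key : ∀ S, IsCompressed f (N + 3 + 1) S → ∀ c ∈ segment (N + 3) 1 (N / 2 + 2),
      insert c {e0} ∈ S 2 ∧ insert c ∅ ∈ S 2 := by
    intro S hS c hc
    rw [mem_segment] at hc
    have h0c : e0 < c := by rw [Fin.lt_def]; simp only [e0]; omega
    have h2 := hS.pair_mem_two (by omega) h01 (by simp only [e1]; omega) h0c (by omega)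
    exact ⟨h2, hS.down 2 (by omega) _ h2 _ (by simp)⟩
  have h1 := star_flow_two (N := N) (a := 2) hS.cont (p := {e0}) (q := ∅)
    (K := segment (N + 3) 1 (N / 2 + 2)) (by simp) (by simp)
    (by
      rw [Finset.disjoint_left]
      intro c hc h
      rw [mem_segment] at hc
      simp only [Finset.union_empty, Finset.mem_singleton, e0] at h
      subst h
      simp at hc)
    (by
      rw [Finset.card_compl]
      simp)
    (fun c hc => (key S hS c hc).1)
    (fun c hc h => compl_notMem_of_mem_dual (r := 2) (by omega) (key _ hd c hc).2
      (by rwa [show N + 3 + 1 - 2 = 2 + N by omega]))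
    (fun c hc => (key S hS c hc).2)
    (fun c hc h => compl_notMem_of_mem_dual (r := 2) (by omega) (key _ hd c hc).1
      (by rwa [show N + 3 + 1 - 2 = 2 + N by omega]))
  rw [hK] at h1
  exact absurd h1 (not_le.2 (sum_starLoad_lt_two (by omega)))

/-- In three dimensions, `2` failures cannot withhold a message for `5` rounds. -/
theorem not_isCompressed_three {S : ℕ → Set (Finset (Fin 3))} : ¬ IsCompressed 2 5 S := by
  intro hS
  have h2 : ∀ S, IsCompressed 2 5 S → ∀ c : Fin 3, (c : ℕ) < 2 → {c} ∈ S 2 := fun S hS c hc =>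
    hS.singleton_mem_two (a := 0) (by omega) (by simp) (by omega)
  have hx := h2 S hS
  have hy : ∀ c : Fin 3, (c : ℕ) < 2 → ({c} : Finset (Fin 3))ᶜ ∉ S 3 :=
    fun c hc => compl_notMem_of_mem_dual (r := 2) (by omega) (h2 _ hS.dual c hc)
  by_cases h : {2} ∈ S 2
  · have h1 := card_le_of_load_le hS.cont
      (D := {({0}, {1}ᶜ), ({1}, {0}ᶜ), ({2}, {0}ᶜ), ({2}, {1}ᶜ)}) (N := 1) (a := 2)
      (ℓ := fun _ => 1) (by
        simp only [Finset.mem_insert, Finset.mem_singleton, forall_eq_or_imp, forall_eq]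
        refine ⟨⟨by decide, by decide, hx 0 (by simp), hy 1 (by simp)⟩,
          ⟨by decide, by decide, hx 1 (by simp), hy 0 (by simp)⟩,
          ⟨by decide, by decide, h, hy 0 (by simp)⟩, by decide, by decide, h, hy 1 (by simp)⟩)
      (by decide +kernel)
    rw [show Finset.card _ = 4 by decide] at h1
    norm_num at h1
  · have h' := hS.pair_mem_two_of_singleton_notMem (by omega) (a := 0) (c := 1) (by simp) h
      (by simp) (by simp)
    have h1 := card_le_of_load_le hS.cont
      (D := {({0}, {1}ᶜ), ({1}, {0}ᶜ), ({1, 0}, Finset.univ)}) (N := 1) (a := 2)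
      (ℓ := fun _ => 1) (by
        simp only [Finset.mem_insert, Finset.mem_singleton, forall_eq_or_imp, forall_eq]
        refine ⟨⟨by decide, by decide, hx 0 (by simp), hy 1 (by simp)⟩,
          ⟨by decide, by decide, hx 1 (by simp), hy 0 (by simp)⟩, by decide, by decide, h',
          fun h => hS.univ_notMem (containment_mono hS.cont.mono (by omega) h)⟩)
      (by decide +kernel)
    rw [show Finset.card _ = 3 by decide] at h1
    norm_num at h1

/-- In four dimensions, `3` failures cannot withhold a message for `6` rounds. -/
theorem not_isCompressed_four {S : ℕ → Set (Finset (Fin 4))} : ¬ IsCompressed 3 6 S := by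
  intro hS
  have h2 : ∀ S, IsCompressed 3 6 S → ∀ c : Fin 4, (c : ℕ) < 3 → {c} ∈ S 2 := fun S hS c hc =>
    hS.singleton_mem_two (a := 0) (by omega) (by simp) (by omega)
  have hx := h2 S hS
  have hy : ∀ c : Fin 4, (c : ℕ) < 3 → ({c} : Finset (Fin 4))ᶜ ∉ S 4 :=
    fun c hc => compl_notMem_of_mem_dual (r := 2) (by omega) (h2 _ hS.dual c hc)
  by_cases h : {3} ∈ S 2
  · have hx' : ∀ c : Fin 4, {c} ∈ S 2 := by
      intro c
      by_cases hc : (c : ℕ) < 3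
      · exact hx c hc
      · obtain rfl : c = 3 := by omega
        exact h
    have h1 := card_le_of_load_le hS.cont
      (D := ((Finset.univ ×ˢ {0, 1, 2} : Finset (Fin 4 × Fin 4)).filter
        fun c => c.1 ≠ c.2).image fun c => ({c.1}, {c.2}ᶜ)) (N := 2) (a := 2)
      (ℓ := fun _ => 2) (by
        intro δ hδ
        obtain ⟨⟨c, c'⟩, hc, rfl⟩ := Finset.mem_image.1 hδ
        have hc' : (c' : ℕ) < 3 := by revert c c'; decide
        have hcc : c ≠ c' := (Finset.mem_filter.1 hc).2
        refine ⟨by simpa using hcc.symm, ?_, hx' c, hy c' hc'⟩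
        clear hδ hc hc'
        revert c c'
        decide)
      (by decide +kernel)
    rw [show Finset.card _ = 9 by decide +kernel] at h1
    norm_num [Finset.sum_range_succ] at h1
  · have h' := hS.pair_mem_two_of_singleton_notMem (by omega) (a := 0) (c := 1) (by simp) h
      (by simp) (by simp)
    -- The count of failures is tight for the six intervals from singletons. The interval from
    -- `{1, 0}` has other arcs in each round, so that it cannot be cut in addition.
    have h1 := card_le_sum_load (S := S) (N := 2) (a := 2)
      (D := starPairs ∅ ∅ {0, 1, 2}) (starPairs_prop (by simp) (by simp) (by simp)
        (fun c hc => hx c (by revert c; decide)) (fun c hc => hy c (by revert c; decide)))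
    have h0 := card_le_sum_load (S := S) (N := 1) (a := 2) (D := {({1, 0}, {2}ᶜ)}) (by
      simp only [Finset.mem_singleton, forall_eq]
      exact ⟨by decide, by decide, h', fun h => hy 2 (by simp) (hS.cont.mono 3 h)⟩)
    rw [show (starPairs ∅ ∅ {0, 1, 2} : Finset (Finset (Fin 4) × Finset (Fin 4))).card = 6 by
      decide +kernel] at h1
    have b2 : ∑ p ∈ blocked S 2, (load (starPairs ∅ ∅ {0, 1, 2}) 0 p
        + 2 * load {({1, 0}, {2}ᶜ)} 0 p) ≤ 3 * 2 :=
      sum_blocked_le hS.cont 2 (by decide +kernel)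
    have b3 : ∑ p ∈ blocked S 3, load (starPairs ∅ ∅ {0, 1, 2}) 1 p ≤ 3 * 2 :=
      sum_blocked_le hS.cont 3 (by decide +kernel)
    rw [Finset.sum_add_distrib, ← Finset.mul_sum] at b2
    simp only [← Finset.sum_div, ← Nat.cast_sum] at h0 h1
    simp [Finset.sum_range_succ] at h0 h1
    have b2' : ((∑ p ∈ blocked S 2, load (starPairs ∅ ∅ {0, 1, 2}) 0 p : ℕ) : ℚ)
        + 2 * ((∑ p ∈ blocked S 2, load {({1, 0}, {2}ᶜ)} 0 p : ℕ) : ℚ) ≤ 6 := by exact_mod_cast b2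
    have b3' : ((∑ p ∈ blocked S 3, load (starPairs ∅ ∅ {0, 1, 2}) 1 p : ℕ) : ℚ) ≤ 6 := by
      exact_mod_cast b3
    push_cast at b2' b3'
    linarith

/-- A compressed containment with `4` failures per round that lasts for `7` rounds in five
dimensions would inform four neighbours of the source by time `2`: otherwise two neighbours of its
first neighbour are informed as well, and the intervals that start from these cannot be cut in addition
to those that start from the first three neighbours of the source. -/
theorem singleton_mem_two_of_isCompressed_five {S : ℕ → Set (Finset (Fin 5))}
    (hS : IsCompressed 4 7 S) : {3} ∈ S 2 := by
  have h2 : ∀ S, IsCompressed 4 7 S → ∀ c : Fin 5, (c : ℕ) < 3 → {c} ∈ S 2 := fun S hS c hc =>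
    hS.singleton_mem_two (a := 0) (by omega) (by simp) (by omega)
  have hx := h2 S hS
  have hy : ∀ c : Fin 5, (c : ℕ) < 3 → ({c} : Finset (Fin 5))ᶜ ∉ S 5 :=
    fun c hc => compl_notMem_of_mem_dual (r := 2) (by omega) (h2 _ hS.dual c hc)
  by_contra h
  have h1' := hS.pair_mem_two_of_singleton_notMem (by omega) (a := 0) (c := 1) (by simp) h
    (by simp) (by simp)
  have h2' := hS.pair_mem_two_of_singleton_notMem (by omega) (a := 0) (c := 2) (by simp) h
    (by simp) (by simp)
  -- The flows from the pairs use other arcs than those from the singletons. With weight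
  -- `2 / 3` on the former, no arc carries more than the arcs of the singletons do: `b2`, `b3`, `b4`
  -- state this with denominators cleared.
  have h1 := card_le_sum_load (S := S) (N := 3) (a := 2)
    (D := starPairs ∅ ∅ {0, 1, 2}) (starPairs_prop (by simp) (by simp) (by simp)
      (fun c hc => hx c (by revert c; decide)) (fun c hc => hy c (by revert c; decide)))
  have h0 := card_le_sum_load (S := S) (N := 2) (a := 2)
    (D := {({1, 0}, {2}ᶜ), ({2, 0}, {1}ᶜ)}) (by
      simp only [Finset.mem_insert, Finset.mem_singleton, forall_eq_or_imp, forall_eq]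
      exact ⟨⟨by decide, by decide, h1', fun h => hy 2 (by simp) (hS.cont.mono 4 h)⟩,
        by decide, by decide, h2', fun h => hy 1 (by simp) (hS.cont.mono 4 h)⟩)
  rw [show (starPairs ∅ ∅ {0, 1, 2} : Finset (Finset (Fin 5) × Finset (Fin 5))).card = 6 by
    decide +kernel] at h1
  rw [show Finset.card _ = 2 by decide +kernel] at h0
  have b2 : ∑ p ∈ blocked S 2, (load (starPairs ∅ ∅ {0, 1, 2}) 0 p
      + load {({1, 0}, {2}ᶜ), ({2, 0}, {1}ᶜ)} 0 p) ≤ 4 * 2 :=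
    sum_blocked_le hS.cont 2 (by decide +kernel)
  have b3 : ∑ p ∈ blocked S 3, (load (starPairs ∅ ∅ {0, 1, 2}) 1 p
      + 2 * load {({1, 0}, {2}ᶜ), ({2, 0}, {1}ᶜ)} 1 p) ≤ 4 * 2 :=
    sum_blocked_le hS.cont 3 (by decide +kernel)
  have b4 : ∑ p ∈ blocked S 4, load (starPairs ∅ ∅ {0, 1, 2}) 2 p ≤ 4 * 2 :=
    sum_blocked_le hS.cont 4 (by decide +kernel)
  rw [Finset.sum_add_distrib] at b2
  rw [Finset.sum_add_distrib, ← Finset.mul_sum] at b3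
  simp only [← Finset.sum_div, ← Nat.cast_sum] at h0 h1
  norm_num [Finset.sum_range_succ] at h0 h1
  have b2' := (Nat.cast_le (α := ℚ)).2 b2
  have b3' := (Nat.cast_le (α := ℚ)).2 b3
  have b4' := (Nat.cast_le (α := ℚ)).2 b4
  push_cast at b2' b3' b4'
  linarith

/-- In five dimensions, `4` failures cannot withhold a message for `7` rounds. -/
theorem not_isCompressed_five {S : ℕ → Set (Finset (Fin 5))} : ¬ IsCompressed 4 7 S := by
  intro hS
  have h2 : ∀ S, IsCompressed 4 7 S → ∀ c ∈ segment 5 0 4, insert c ∅ ∈ S 2 := by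
    intro S hS c hc
    have h3 := singleton_mem_two_of_isCompressed_five hS
    rw [mem_segment] at hc
    by_cases h : c = 3
    · subst h; exact h3
    · exact hS.singleton_mem_two (a := 0) (by omega) (by simp) (by omega)
  have h1 := star_flow (N := 3) (a := 2) hS.cont (p := ∅) (q := ∅) (K := segment 5 0 4)
    (by simp) (by simp) (by simp) (h2 S hS)
    (fun c hc => compl_notMem_of_mem_dual (r := 2) (by omega) (h2 _ hS.dual c hc))
  rw [card_segment (by omega)] at h1
  norm_num [Finset.sum_range_succ, starLoad] at h1

/-- With `n - 1` failures, `n + 2` rounds inform the antipode: the intervals from `{c}` to `{c'}ᶜ`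
cannot be cut. -/
theorem not_isCompressed_sub_one {n f : ℕ} (hn : 3 ≤ n) (hf : f + 1 = n)
    {S : ℕ → Set (Finset (Fin n))} : ¬ IsCompressed f (n + 2) S := by
  intro hS
  rcases (show n = 3 ∨ n = 4 ∨ n = 5 ∨ 6 ≤ n by omega) with rfl | rfl | rfl | hn
  · obtain rfl : f = 2 := by omega
    exact not_isCompressed_three hS
  · obtain rfl : f = 3 := by omega
    exact not_isCompressed_four hS
  · obtain rfl : f = 4 := by omega
    exact not_isCompressed_five hS
  obtain ⟨N, rfl⟩ : ∃ N, n = N + 2 := ⟨n - 2, by omega⟩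
  have hK : (segment (N + 2) 0 (N / 2 + 2)).card = N / 2 + 2 := card_segment (by omega)
  have key : ∀ S, IsCompressed f (N + 2 + 2) S → ∀ c ∈ segment (N + 2) 0 (N / 2 + 2),
      insert c ∅ ∈ S 2 := by
    intro S hS c hc
    rw [mem_segment] at hc
    exact hS.singleton_mem_two (by omega) (a := 0) (by simp; omega) (by omega)
  have h1 := star_flow (N := N) (a := 2) hS.cont (p := ∅) (q := ∅)
    (K := segment (N + 2) 0 (N / 2 + 2)) (by simp) (by simp) (by simp) (key S hS)
    (fun c hc h => compl_notMem_of_mem_dual (r := 2) (by omega) (key _ hS.dual c hc)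
      (by rwa [show N + 2 + 2 - 2 = 2 + N by omega]))
  rw [hK] at h1
  exact absurd h1 (not_le.2 (sum_starLoad_lt_one (by omega) (by omega)))

/-! ### Consensus on the hypercube and containments of the cube -/

theorem IsContainment.mono_right {V : Type} {G : Digraph V} {f f' : ℕ} (h : f ≤ f')
    {S : ℕ → Set V} (hS : IsContainment G f S) : IsContainment G f' S :=
  ⟨hS.mono, fun r => (hS.leak_le r).trans (by exact_mod_cast h)⟩

theorem consensusSolvableIn_hypercube {n f T : ℕ}
    (h : ∀ S : ℕ → Set (Finset (Fin n)), ¬ IsCompressed f T S) :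
    ConsensusSolvableIn (mobileScheme (boundedOmissions (hypercube n) f)) T := by
  refine consensusSolvableIn_of_forall_containment (fun _ => false) fun S h0 hS => ?_
  by_contra hT
  let e := Equiv.ofBijective _ (offset_bijective (n := n) fun _ => false)
  have he : ∀ x, offset (fun _ => false) (e.symm x) = x := fun x => e.apply_symm_apply x
  have hS' : IsContainment (cube (Fin n)) f fun r => e.symm ⁻¹' S r :=
    hS.preimage e.symm.bijective fun x y => by
      rw [← cube_adj_offset fun _ => false, he, he]
  obtain ⟨S', h'⟩ := exists_isCompressed (T := T) hS'
    (by
      have : e.symm ∅ = fun _ => false := by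
        rw [Equiv.symm_apply_eq]
        exact (offset_self _).symm
      simpa [this] using h0)
    (fun h => hT (by
      rw [Set.eq_univ_iff_forall] at h ⊢
      intro x
      simpa using h (e x)))
  exact h S' h'

theorem not_consensusSolvableIn_hypercube {n f T : ℕ} {S : ℕ → Set (Finset (Fin n))}
    (hS : IsContainment (cube (Fin n)) f S) (h0 : ∅ ∈ S 0) (hT : Finset.univ ∉ S T) {k : ℕ}
    (hk : k ≤ T) : ¬ ConsensusSolvableIn (mobileScheme (boundedOmissions (hypercube n) f)) k := by
  refine not_consensusSolvableIn fun v => ⟨fun r => offset v ⁻¹' S r, ?_, ?_, fun h => hT ?_⟩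
  · simpa [offset_self] using h0
  · exact hS.preimage (offset_bijective v) (cube_adj_offset v)
  · obtain ⟨x, hx⟩ := (offset_bijective v).2 Finset.univ
    refine containment_mono hS.mono hk ?_
    rw [← hx]
    exact Set.eq_univ_iff_forall.1 h x

/-! ### Withholding the message -/

theorem encard_le_of_subset_image {β γ : Type} {s : Set β} (C : Finset γ) (g : γ → β)
    (h : s ⊆ g '' C) {f : ℕ} (hC : C.card ≤ f) : s.encard ≤ (f : ℕ∞) := by
  refine (Set.encard_le_encard h).trans ((Set.encard_image_le _ _).trans ?_)
  rw [Set.encard_coe_eq_coe_finsetCard]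
  exact_mod_cast hC

theorem encard_le_of_forall_notMem {β : Type} {s : Set β} (h : ∀ a, a ∉ s) {f : ℕ} :
    s.encard ≤ (f : ℕ∞) := by
  rw [Set.eq_empty_iff_forall_notMem.2 h]
  simp

/-- With `n` failures per round the source can be isolated forever. -/
theorem isContainment_isolate {n f : ℕ} (hf : n ≤ f) :
    IsContainment (cube (Fin n)) f fun _ => {∅} := by
  refine ⟨fun r => subset_rfl, fun r => ?_⟩
  refine encard_le_of_subset_image Finset.univ (fun c => (∅, {c})) ?_ (by simpa using hf)
  rintro ⟨x, y⟩ ⟨h1, h2, h3⟩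
  simp only [Set.mem_singleton_iff] at h2 h3
  subst h2
  obtain ⟨c, ⟨-, h⟩ | ⟨-, h⟩⟩ := (cube_adj_iff (x := ∅) (y := y)).1 h1
  · exact ⟨c, by simp, by simp [h]⟩
  · exact absurd h.symm (Finset.insert_ne_empty _ _)

/-- Without failures the message travels one edge per round. -/
theorem isContainment_ball {n f : ℕ} :
    IsContainment (cube (Fin n)) f fun r => {x | x.card ≤ r} := by
  refine ⟨fun r x hx => Nat.le_succ_of_le hx, fun r => encard_le_of_forall_notMem ?_⟩
  rintro ⟨x, y⟩ ⟨h1, h2, h3⟩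
  simp only [Set.mem_ofPred_eq] at h2 h3
  obtain ⟨c, ⟨h, h'⟩ | ⟨h, h'⟩⟩ := (cube_adj_iff (x := x) (y := y)).1 h1
  · rw [h', Finset.card_insert_of_notMem h] at h3
    omega
  · rw [h', Finset.card_insert_of_notMem h] at h2
    omega

/-- A containment with `n - 2` failures per round that misses the antipode at time `n`: the failures
of the first two rounds ensure that the vertices at distance `r` informed at time `r` all contain
`a`, so that `{a}ᶜ` is late, and those of the last two delay `{b}ᶜ` and the antipode. From time
`n + 1` on it imposes no condition. -/
def delayOne {n : ℕ} (a b : Fin n) (r : ℕ) : Set (Finset (Fin n)) :=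
  {x | (r = 0 → x = ∅) ∧ (r = 1 → x = ∅ ∨ x = {a} ∨ x = {b}) ∧
    (2 ≤ r → r + 2 ≤ n → x.card < r ∨ (x.card = r ∧ a ∈ x)) ∧
    (r + 1 = n → x.card < r ∨ (x.card = r ∧ a ∈ x ∧ b ∈ x)) ∧ (r = n → x.card < n)}

theorem card_univ_sdiff_pair {n : ℕ} {a b : Fin n} (hab : a ≠ b) :
    (Finset.univ \ {a, b}).card + 2 = n := by
  have := Finset.card_le_univ ({a, b} : Finset (Fin n))
  rw [Finset.card_sdiff_of_subset (Finset.subset_univ _)]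
  rw [Finset.card_pair hab, Fintype.card_fin] at *
  simp
  omega

theorem eq_compl_singleton {n : ℕ} {x : Finset (Fin n)} {a : Fin n} (hx : x.card + 1 = n)
    (ha : a ∉ x) : x = {a}ᶜ := by
  refine Finset.eq_of_subset_of_card_le (fun b hb => ?_) ?_
  · rw [Finset.mem_compl, Finset.mem_singleton]
    rintro rfl
    exact ha hb
  · rw [Finset.card_compl, Finset.card_singleton, Fintype.card_fin]
    omega

theorem eq_compl_of_insert_eq {n : ℕ} {x y : Finset (Fin n)} {c : Fin n} (hc : c ∉ x)
    (h : yᶜ = insert c x) : x = (insert c y)ᶜ := by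
  ext a
  have h1 : a ∈ yᶜ ↔ a ∈ insert c x := by rw [h]
  rw [Finset.mem_compl, Finset.mem_insert] at h1
  rw [Finset.mem_compl, Finset.mem_insert]
  by_cases e : a = c
  · subst e; tauto
  · tauto

theorem isContainment_delayOne {n f : ℕ} (hn : 4 ≤ n) (hf : f + 2 = n) {a b : Fin n}
    (hab : a ≠ b) : IsContainment (cube (Fin n)) f (delayOne a b) := by
  have hC : (Finset.univ \ {a, b}).card ≤ f := by
    have := card_univ_sdiff_pair hab
    omega
  refine ⟨fun r x hx => ?_, fun r => ?_⟩
  · obtain ⟨h0, h1, h2, h3, h4⟩ := hx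
    have hle : x.card ≤ r ∨ n ≤ r := by
      rcases (show r = 0 ∨ r = 1 ∨ (2 ≤ r ∧ r + 2 ≤ n) ∨ r + 1 = n ∨ n ≤ r by omega) with
        h | h | h | h | h
      · simp [h0 h]
      · rcases h1 h with h | h | h <;> simp [h] <;> omega
      · have := h2 h.1 h.2; omega
      · have := h3 h; omega
      · exact Or.inr h
    refine ⟨by omega, fun h => Or.inl (h0 (by omega)), fun _ _ => Or.inl (by omega),
      fun _ => Or.inl (by omega), fun _ => by omega⟩
  · rcases (show r = 0 ∨ r = 1 ∨ (2 ≤ r ∧ r + 3 ≤ n) ∨ r + 2 = n ∨ r + 1 = n ∨ n ≤ r by omega)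
      with h | h | h | h | h | h
    · subst h
      refine encard_le_of_subset_image _ (fun c => (∅, {c})) ?_ hC
      rintro ⟨x, y⟩ ⟨h1, h2, h3⟩
      have hx : x = ∅ := h2.1 rfl
      subst hx
      obtain ⟨c, ⟨-, h⟩ | ⟨-, h⟩⟩ := (cube_adj_iff (x := ∅) (y := y)).1 h1
      · simp only [insert_empty_eq] at h
        subst h
        refine ⟨c, ?_, rfl⟩
        simp only [Finset.coe_sdiff, Finset.coe_univ, Set.mem_sdiff, Set.mem_univ, true_and,
          Finset.mem_coe, Finset.mem_insert, Finset.mem_singleton]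
        rintro (rfl | rfl)
        · exact h3 ⟨by omega, by simp, by omega, by omega, by omega⟩
        · exact h3 ⟨by omega, by simp, by omega, by omega, by omega⟩
      · exact absurd h.symm (Finset.insert_ne_empty _ _)
    · subst h
      refine encard_le_of_subset_image _ (fun c => ({b}, {c, b})) ?_ hC
      rintro ⟨x, y⟩ ⟨h1, h2, h3⟩
      have hx := h2.2.1 rfl
      simp only at hx h3
      have hxc : x.card ≤ 1 := by rcases hx with rfl | rfl | rfl <;> simp
      have hy : ¬ (y.card < 2 ∨ (y.card = 2 ∧ a ∈ y)) := fun h =>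
        h3 ⟨by omega, by omega, fun _ _ => h, by omega, by omega⟩
      obtain ⟨c, ⟨h, h'⟩ | ⟨h, h'⟩⟩ := (cube_adj_iff (x := x) (y := y)).1 h1
      · subst h'
        rw [Finset.card_insert_of_notMem h] at hy
        rcases hx with rfl | rfl | rfl
        · simp at hy
        · simp at hy
        · refine ⟨c, ?_, rfl⟩
          simp only [Finset.card_singleton, Finset.mem_insert, Finset.mem_singleton] at hy h
          simp only [Finset.coe_sdiff, Finset.coe_univ, Set.mem_sdiff, Set.mem_univ, true_and,
            Finset.mem_coe, Finset.mem_insert, Finset.mem_singleton]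
          have : a = c ↔ c = a := eq_comm
          tauto
      · rw [h', Finset.card_insert_of_notMem h] at hxc
        omega
    · refine encard_le_of_forall_notMem ?_
      rintro ⟨x, y⟩ ⟨h1, h2, h3⟩
      have hx := h2.2.2.1 h.1 (by omega)
      simp only at hx h3
      refine h3 ⟨by omega, by omega, fun _ _ => ?_, by omega, by omega⟩
      obtain ⟨c, ⟨h, rfl⟩ | ⟨h, h'⟩⟩ := (cube_adj_iff (x := x) (y := y)).1 h1
      · rw [Finset.card_insert_of_notMem h, Finset.mem_insert]
        rcases hx with hx | hx
        · left; omega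
        · right; exact ⟨by omega, Or.inr hx.2⟩
      · rw [h', Finset.card_insert_of_notMem h] at hx
        left; omega
    · refine encard_le_of_subset_image _ (fun c => ({c, b}ᶜ, {b}ᶜ)) ?_ hC
      rintro ⟨x, y⟩ ⟨h1, h2, h3⟩
      have hx := h2.2.2.1 (by omega) (by omega)
      simp only at hx h3
      have hy : ¬ (y.card < r + 1 ∨ (y.card = r + 1 ∧ a ∈ y ∧ b ∈ y)) := fun h =>
        h3 ⟨by omega, by omega, by omega, fun _ => h, by omega⟩
      obtain ⟨c, ⟨h, h'⟩ | ⟨h, h'⟩⟩ := (cube_adj_iff (x := x) (y := y)).1 h1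
      · subst h'
        rw [Finset.card_insert_of_notMem h] at hy
        have hxr : x.card = r ∧ a ∈ x := hx.resolve_left (by omega)
        have hb : b ∉ insert c x := fun hb =>
          hy (Or.inr ⟨by omega, Finset.mem_insert_of_mem hxr.2, hb⟩)
        have e : insert c x = {b}ᶜ :=
          eq_compl_singleton (by rw [Finset.card_insert_of_notMem h]; omega) hb
        refine ⟨c, ?_, by rw [e, eq_compl_of_insert_eq h e.symm]⟩
        simp only [Finset.coe_sdiff, Finset.coe_univ, Set.mem_sdiff, Set.mem_univ, true_and,
          Finset.mem_coe, Finset.mem_insert, Finset.mem_singleton]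
        rintro (rfl | rfl)
        · exact h hxr.2
        · exact hb (Finset.mem_insert_self _ _)
      · rw [h', Finset.card_insert_of_notMem h] at hx
        omega
    · refine encard_le_of_subset_image _ (fun c => ({c}ᶜ, Finset.univ)) ?_ hC
      rintro ⟨x, y⟩ ⟨h1, h2, h3⟩
      have hx := h2.2.2.2.1 h
      simp only at hx h3
      have hy : ¬ (y.card < n) := fun h =>
        h3 ⟨by omega, by omega, by omega, by omega, fun _ => h⟩
      obtain ⟨c, ⟨h', h''⟩ | ⟨h', h''⟩⟩ := (cube_adj_iff (x := x) (y := y)).1 h1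
      · subst h''
        rw [Finset.card_insert_of_notMem h'] at hy
        have hxr : x.card = r ∧ a ∈ x ∧ b ∈ x := hx.resolve_left (by omega)
        have e : insert c x = Finset.univ := Finset.eq_univ_of_card _ (by
          rw [Finset.card_insert_of_notMem h', Fintype.card_fin]; omega)
        refine ⟨c, ?_, by rw [e, eq_compl_singleton (by omega) h']⟩
        simp only [Finset.coe_sdiff, Finset.coe_univ, Set.mem_sdiff, Set.mem_univ, true_and,
          Finset.mem_coe, Finset.mem_insert, Finset.mem_singleton]
        rintro (rfl | rfl)
        · exact h' hxr.2.1
        · exact h' hxr.2.2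
      · rw [h'', Finset.card_insert_of_notMem h'] at hx
        omega
    · refine encard_le_of_forall_notMem ?_
      rintro ⟨x, y⟩ ⟨-, -, h3⟩
      exact h3 ⟨by omega, by omega, by omega, by omega, by omega⟩

/-- A containment with `n - 1` failures per round that misses the antipode at time `n + 1`: the
failures of the first two rounds delay every vertex by one round, except `∅` and `{a}`, and those of
the last two delay `{a}ᶜ` and the antipode once more. From time `n + 2` on it imposes no
condition. -/
def delayTwo {n : ℕ} (a : Fin n) (r : ℕ) : Set (Finset (Fin n)) :=
  {x | (r = 0 → x = ∅) ∧ (r = 1 → x = ∅ ∨ x = {a}) ∧ (2 ≤ r → r ≤ n → x.card < r) ∧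
    (r = n → x ≠ {a}ᶜ) ∧ (r = n + 1 → x ≠ Finset.univ)}

theorem isContainment_delayTwo {n f : ℕ} (hn : 3 ≤ n) (hf : f + 1 = n) (a : Fin n) :
    IsContainment (cube (Fin n)) f (delayTwo a) := by
  have hC : ({a}ᶜ : Finset (Fin n)).card ≤ f := by
    rw [Finset.card_compl, Finset.card_singleton, Fintype.card_fin]
    omega
  have hcompl : ({a}ᶜ : Finset (Fin n)).card + 1 = n := by
    rw [Finset.card_compl, Finset.card_singleton, Fintype.card_fin]
    omega
  refine ⟨fun r x hx => ?_, fun r => ?_⟩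
  · obtain ⟨h0, h1, h2, h3, h4⟩ := hx
    have hle : r + 1 ≤ n + 1 → x.card < r + 1 ∧ (2 ≤ r → x.card < r) := by
      intro hr
      rcases (show r = 0 ∨ r = 1 ∨ (2 ≤ r ∧ r ≤ n) by omega) with h | h | h
      · simp [h0 h, h]
      · rcases h1 h with h' | h' <;> simp [h', h]
      · have := h2 h.1 h.2; omega
    refine ⟨by omega, fun h => Or.inl (h0 (by omega)), fun _ _ => by omega, fun h h' => ?_,
      fun h h' => ?_⟩
    · subst h'; omega
    · subst h'
      rw [Finset.card_univ, Fintype.card_fin] at hle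
      omega
  · rcases (show r = 0 ∨ r = 1 ∨ (2 ≤ r ∧ r + 2 ≤ n) ∨ r + 1 = n ∨ r = n ∨ n < r by omega)
      with h | h | h | h | h | h
    · subst h
      refine encard_le_of_subset_image _ (fun c => (∅, {c})) ?_ hC
      rintro ⟨x, y⟩ ⟨h1, h2, h3⟩
      have hx : x = ∅ := h2.1 rfl
      subst hx
      obtain ⟨c, ⟨-, h⟩ | ⟨-, h⟩⟩ := (cube_adj_iff (x := ∅) (y := y)).1 h1
      · simp only [insert_empty_eq] at h
        subst h
        refine ⟨c, ?_, rfl⟩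
        rw [Finset.mem_coe, Finset.mem_compl, Finset.mem_singleton]
        rintro rfl
        exact h3 ⟨by omega, by simp, by omega, by omega, by omega⟩
      · exact absurd h.symm (Finset.insert_ne_empty _ _)
    · subst h
      refine encard_le_of_subset_image _ (fun c => ({a}, {c, a})) ?_ hC
      rintro ⟨x, y⟩ ⟨h1, h2, h3⟩
      have hx := h2.2.1 rfl
      simp only at hx h3
      have hy : ¬ (y.card < 2) := fun h =>
        h3 ⟨by omega, by omega, fun _ _ => h, by omega, by omega⟩
      obtain ⟨c, ⟨h, h'⟩ | ⟨h, h'⟩⟩ := (cube_adj_iff (x := x) (y := y)).1 h1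
      · subst h'
        rcases hx with rfl | rfl
        · simp at hy
        · exact ⟨c, by simpa using h, rfl⟩
      · have : x.card ≤ 1 := by rcases hx with rfl | rfl <;> simp
        rw [h', Finset.card_insert_of_notMem h] at this
        omega
    · refine encard_le_of_forall_notMem ?_
      rintro ⟨x, y⟩ ⟨h1, h2, h3⟩
      have hx := h2.2.2.1 h.1 (by omega)
      simp only at hx h3
      refine h3 ⟨by omega, by omega, fun _ _ => ?_, by omega, by omega⟩
      obtain ⟨c, ⟨h, rfl⟩ | ⟨h, h'⟩⟩ := (cube_adj_iff (x := x) (y := y)).1 h1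
      · rw [Finset.card_insert_of_notMem h]
        omega
      · rw [h', Finset.card_insert_of_notMem h] at hx
        omega
    · refine encard_le_of_subset_image _ (fun c => ({c, a}ᶜ, {a}ᶜ)) ?_ hC
      rintro ⟨x, y⟩ ⟨h1, h2, h3⟩
      have hx := h2.2.2.1 (by omega) (by omega)
      simp only at hx h3
      have hyc : y.card < r + 1 := by
        obtain ⟨c, ⟨h, rfl⟩ | ⟨h, h'⟩⟩ := (cube_adj_iff (x := x) (y := y)).1 h1
        · rw [Finset.card_insert_of_notMem h]
          omega
        · rw [h', Finset.card_insert_of_notMem h] at hx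
          omega
      have hy : y = {a}ᶜ := by
        by_contra hy
        exact h3 ⟨by omega, by omega, fun _ _ => hyc, fun _ => hy, by omega⟩
      subst hy
      obtain ⟨c, ⟨h, h'⟩ | ⟨h, h'⟩⟩ := (cube_adj_iff (x := x) (y := {a}ᶜ)).1 h1
      · refine ⟨c, ?_, by rw [eq_compl_of_insert_eq h h']⟩
        rw [Finset.mem_coe, h']
        exact Finset.mem_insert_self _ _
      · rw [h', Finset.card_insert_of_notMem h] at hx
        omega
    · refine encard_le_of_subset_image _ (fun c => ({c}ᶜ, Finset.univ)) ?_ hC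
      rintro ⟨x, y⟩ ⟨h1, h2, h3⟩
      have hx := h2.2.2.2.1 h
      simp only at hx h3
      have hy : y = Finset.univ := by
        by_contra hy
        exact h3 ⟨by omega, by omega, by omega, by omega, fun _ => hy⟩
      subst hy
      obtain ⟨c, ⟨h', h''⟩ | ⟨h', h''⟩⟩ := (cube_adj_iff (x := x) (y := Finset.univ)).1 h1
      · have hc : x.card + 1 = n := by
          rw [← Finset.card_insert_of_notMem h', ← h'', Finset.card_univ, Fintype.card_fin]
        have e := eq_compl_singleton hc h'
        refine ⟨c, ?_, by rw [e]⟩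
        rw [Finset.mem_coe, Finset.mem_compl, Finset.mem_singleton]
        rintro rfl
        exact hx e
      · exact absurd (Finset.mem_univ c) h'
    · refine encard_le_of_forall_notMem ?_
      rintro ⟨x, y⟩ ⟨-, h2, h3⟩
      exact h3 ⟨by omega, by omega, by omega, by omega, by omega⟩

end MobileOmission

open MobileOmission in
theorem mainTheorem6 (n f : ℕ) :
    (1 ≤ n → n ≤ f →
      ¬ MobileOmission.ConsensusSolvable
        (MobileOmission.mobileScheme
          (MobileOmission.boundedOmissions (MobileOmission.hypercube n) f))) ∧
    (3 ≤ n → f + 1 = n →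
      MobileOmission.ConsensusSolvableInExactly
        (MobileOmission.mobileScheme
          (MobileOmission.boundedOmissions (MobileOmission.hypercube n) f)) (n + 2)) ∧
    (4 ≤ n → f + 2 = n →
      MobileOmission.ConsensusSolvableInExactly
        (MobileOmission.mobileScheme
          (MobileOmission.boundedOmissions (MobileOmission.hypercube n) f)) (n + 1)) ∧
    (f + 2 < n →
      MobileOmission.ConsensusSolvableInExactly
        (MobileOmission.mobileScheme
          (MobileOmission.boundedOmissions (MobileOmission.hypercube n) f)) n) := by
  refine ⟨fun hn hf h => ?_, fun hn hf => ⟨?_, fun k hk => ?_⟩, fun hn hf => ⟨?_, fun k hk => ?_⟩,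
    fun hf => ⟨?_, fun k hk => ?_⟩⟩
  · obtain ⟨k, hk⟩ := consensusSolvableIn_of_consensusSolvable h
    refine not_consensusSolvableIn_hypercube (isContainment_isolate hf) rfl ?_ le_rfl hk
    intro h
    have := congrArg Finset.card (Set.mem_singleton_iff.1 h)
    simp at this
    omega
  · exact consensusSolvableIn_hypercube fun S => not_isCompressed_sub_one hn hf
  · by_contra hlt
    refine not_consensusSolvableIn_hypercube (T := n + 1)
      (isContainment_delayTwo hn hf ⟨0, by omega⟩) ?_ ?_ (by omega) hk
    · exact ⟨fun _ => rfl, by omega, by omega, by omega, by omega⟩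
    · exact fun h => h.2.2.2.2 rfl rfl
  · exact consensusSolvableIn_hypercube fun S => not_isCompressed_sub_two (by omega) hf
  · by_contra hlt
    refine not_consensusSolvableIn_hypercube (T := n)
      (isContainment_delayOne hn hf (a := ⟨0, by omega⟩) (b := ⟨1, by omega⟩) (by simp)) ?_ ?_
      (by omega) hk
    · exact ⟨fun _ => rfl, by omega, by omega, by omega, by omega⟩
    · intro h
      have := h.2.2.2.2 rfl
      simp at this
  · refine consensusSolvableIn_hypercube fun S hS => ?_
    obtain ⟨g, rfl⟩ : ∃ g, n = g + 3 := ⟨n - 3, by omega⟩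
    exact not_isCompressed_sub_three rfl
      { hS with cont := hS.cont.mono_right (show f ≤ g by omega) }
  · by_contra hlt
    refine not_consensusSolvableIn_hypercube (T := n - 1) isContainment_ball ?_ ?_ (by omega) hk
    · simp
    · simp
      omega
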